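/- **Theorem 1.2 (Cauchy identity).** Let $x=(x_1,x_2,\ldots)$ and $y=(y_1,y_2,\ldots)$ be two infinite families of independent commuting variables, let $K$ be a field of characteristic $0$, and define $t_i,s_i$ ($i\ge 1$) in the ring $K[[x,y]]$ of formal power series by $i\,t_i=\sum_{k\ge1}x_k^i$ and $i\,s_i=\sum_{\ell\ge1}y_\ell^i$. For a partition $\lambda$ of $n$ let $$\tilde{\mathbf s}_\lambda(x)=\sum_{P}\ \prod_{i\ge1} x_i^{\#\{\text{times } i \text{ appears in } P\}},$$ the sum being over all semi-standard Young tableaux $P$ of shape $\lambda$ with entries in $\{1,2,\ldots\}$ (rows weakly increasing, columns strictly increasing), and let $$\mathbf s_\lambda(t)=\det\big(\mathbf s_{\lambda_i-i+j}(t)\big)_{1\le i,j\le n},\qquad e^{\sum_{i\ge1}t_iz^i}=\sum_{k\ge0}\mathbf s_k(t)z^k,\qquad \mathbf s_k(t)=0\ \text{ for } k<0,$$ where $\lambda_i=0$ for $i$ larger than the number of parts of $\lambda$ (and the empty determinant is $1$). Then, in $K[[x,y]]$, $$\prod_{i,j\ge1}\frac1{1-x_iy_j}=\sum_\lambda\tilde{\mathbf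 s}_\lambda(x)\,\tilde{\mathbf s}_\lambda(y)=\sum_\lambda\mathbf s_\lambda(t)\,\mathbf s_\lambda(s)=e^{\sum_{i\ge1}i\,t_is_i},$$ where $\lambda$ runs over all partitions, including the empty one. All the infinite sums and products converge unconditionally in the sense that each coefficient is eventually constant along the finite partial sums or products. -/

import Mathlib

open scoped MvPowerSeries.WithPiTopology

noncomputable section

/-- The content of a semistandard Young tableau: `content T i` is the number of boxes of `T` with
entry `i`. Entries of `SemistandardYoungTableau` start at `0` instead of `1`; accordingly the
variables `x₁, x₂, …` are indexed from `0`, so that the entry `i` corresponds to `x_{i+1}`. -/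
def SemistandardYoungTableau.content {μ : YoungDiagram} (T : SemistandardYoungTableau μ) :
    ℕ →₀ ℕ :=
  ∑ c ∈ μ.cells, Finsupp.single (T c.1 c.2) 1

/-- Only finitely many semistandard tableaux of a given shape have a given content. -/
theorem SemistandardYoungTableau.finite_content_eq (μ : YoungDiagram) (d : ℕ →₀ ℕ) :
    Finite {T : SemistandardYoungTableau μ // T.content = d} := by
  have key : ∀ T : {T : SemistandardYoungTableau μ // T.content = d}, ∀ c : μ.cells,
      T.1 c.1.1 c.1.2 ∈ d.support := by
    rintro ⟨T, rfl⟩ ⟨c, hc⟩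
    have h : T.content (T c.1 c.2) ≠ 0 := by
      rw [SemistandardYoungTableau.content, Finsupp.finsetSum_apply]
      intro h0
      have := (Finset.sum_eq_zero_iff.mp h0) c hc
      simp at this
    simpa [Finsupp.mem_support_iff] using h
  refine Finite.of_injective
    (fun T (c : μ.cells) => (⟨T.1 c.1.1 c.1.2, key T c⟩ : d.support)) ?_
  intro T T' h
  apply Subtype.ext
  apply SemistandardYoungTableau.ext
  intro i j
  by_cases hc : (i, j) ∈ μ
  · have := congrFun h ⟨(i, j), (YoungDiagram.mem_cells _).mpr hc⟩
    simpa using congrArg Subtype.val this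
  · rw [T.1.zeros hc, T'.1.zeros hc]

/-- The Schur function of shape `μ` in the variables `x₁, x₂, …`, as a formal power series: the sum
over all semistandard tableaux `T` of shape `μ` of the monomials `∏ᵢ xᵢ ^ #{times i appears in T}`.
The coefficient of `x ^ d` is thus the (finite) number of semistandard tableaux of content `d`. -/
def schurFunction (K : Type*) [Field K] (μ : YoungDiagram) : MvPowerSeries ℕ K :=
  fun d => (Nat.card {T : SemistandardYoungTableau μ // T.content = d} : K)

open Classical in
/-- The power sum `∑ᵢ xᵢ ^ k` (for `k ≥ 1`) in infinitely many variables, as a formal power series: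
the coefficient of `x ^ d` is `1` if `x ^ d = xᵢ ^ k` for some `i`, and `0` otherwise. -/
def powerSum (K : Type*) [Field K] (k : ℕ) : MvPowerSeries ℕ K :=
  fun d => if ∃ i : ℕ, d = Finsupp.single i k then 1 else 0

/-- The variable `t_k` with `k t_k = ∑ᵢ xᵢ ^ k`, for `k ≥ 1`. -/
def timeVar (K : Type*) [Field K] (k : ℕ) : MvPowerSeries ℕ K :=
  (k : K)⁻¹ • powerSum K k

/-- The elementary Schur polynomials `s_k(t₁, t₂, …)`, defined by
`exp (∑_{i ≥ 1} t_i z ^ i) = ∑_{k ≥ 0} s_k(t) z ^ k` and `s_k = 0` for `k < 0`.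
The indeterminate `t_i` is `MvPolynomial.X i`; the index `0` is not used. -/
def elemSchurPoly (K : Type*) [Field K] [CharZero K] (k : ℤ) : MvPolynomial ℕ K :=
  if 0 ≤ k then
    PowerSeries.coeff k.toNat
      ((PowerSeries.exp (MvPolynomial ℕ K)).subst
        (PowerSeries.mk fun i : ℕ => if i = 0 then 0 else (MvPolynomial.X i : MvPolynomial ℕ K)))
  else 0

/-- The Schur polynomial `s_μ(t₁, t₂, …) = det (s_{μ_i - i + j}(t))_{1 ≤ i, j ≤ |μ|}`. -/
def schurPoly (K : Type*) [Field K] [CharZero K] (μ : YoungDiagram) : MvPolynomial ℕ K :=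
  Matrix.det (Matrix.of fun i j : Fin μ.card =>
    elemSchurPoly K ((μ.rowLen i : ℤ) - (i : ℤ) + (j : ℤ)))

/-- A power series in one infinite family of variables as a power series in the first family
`x₁, x₂, …` of the two families `x`, `y`. -/
def inX {K : Type*} [Field K] (f : MvPowerSeries ℕ K) : MvPowerSeries (ℕ ⊕ ℕ) K :=
  MvPowerSeries.rename (Function.Embedding.inl : ℕ ↪ ℕ ⊕ ℕ) f

/-- A power series in one infinite family of variables as a power series in the second family
`y₁, y₂, …` of the two families `x`, `y`. -/
def inY {K : Type*} [Field K] (f : MvPowerSeries ℕ K) : MvPowerSeries (ℕ ⊕ ℕ) K :=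
  MvPowerSeries.rename (Function.Embedding.inr : ℕ ↪ ℕ ⊕ ℕ) f

end

/-! Let D be the Euler derivation (`euler`), which multiplies a monomial by its total degree, and
let G = ∑_{k≥1} p_k(x) p_k(y) with p_k the power sums. The product, the sum over partitions and the
exponential all have constant coefficient 1 and satisfy D P = P · 2G. In characteristic 0 this
equation determines P from G coefficient by coefficient, and continuously
(`tendsto_of_euler_eq_mul`), so the three agree and the finite partial products converge. The 2 is
the degree of x_i y_j.

For the exponential, D E = 2G, since i t_i s_i = p_i(x) p_i(y) / i has degree 2i. For the product,
the logarithmic derivative of 1/(1 - u), u = x_i y_j, is 2u/(1 - u), and these add up to 2G. For the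
sum, the equation is Newton's identity, once the part with |λ| = n is known to be the limit of the
h_n of the products x_i y_j with i, j < N (`sum_ofCard_schurEval_mul_schurEval`).

This finite Cauchy identity rests on horizontal strips. Removing the largest entry of a tableau
gives the branching rule (`schurEval_succ`). The local rule exchanges "add a strip, then remove one"
for "remove one, then add one"; this yields Pieri's rule by induction on the number of variables x,
and the Cauchy identity follows by induction on the number of variables y.

Finally, s_λ(t) is the Schur function: Jacobi–Trudi holds in N variables by row operations and
multilinearity (`det_completeInt`), and h_k tends to s_k(t) because both obey Newton's recursion
with p_k = k t_k (`tendsto_completeEval`). -/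

namespace YoungDiagram

/-! ### Young diagrams through their row lengths; horizontal strips. -/

theorem ext_rowLen {μ ν : YoungDiagram} (h : ∀ i, μ.rowLen i = ν.rowLen i) : μ = ν := by
  refine SetLike.ext ?_
  rintro ⟨i, j⟩
  rw [mem_iff_lt_rowLen, mem_iff_lt_rowLen, h]

theorem le_iff_rowLen_le {μ ν : YoungDiagram} : μ ≤ ν ↔ ∀ i, μ.rowLen i ≤ ν.rowLen i := by
  constructor
  · intro h i
    by_contra! hlt
    have h1 : (i, ν.rowLen i) ∈ μ := mem_iff_lt_rowLen.mpr hlt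
    exact absurd (mem_iff_lt_rowLen.mp (h h1)) (lt_irrefl _)
  · rintro h ⟨i, j⟩ hij
    exact mem_iff_lt_rowLen.mpr ((mem_iff_lt_rowLen.mp hij).trans_le (h i))

open Classical in
/-- The Young diagram with row lengths `f`, where `f` is antitone and vanishes somewhere
(and the empty diagram if `f` is not of this kind). -/
noncomputable def ofRows (f : ℕ → ℕ) : YoungDiagram :=
  if h : Antitone f ∧ ∃ n, f n = 0 then
    { cells := ((Finset.range h.2.choose) ×ˢ (Finset.range (f 0))).filter fun c => c.2 < f c.1
      isLowerSet := by
        rintro ⟨i, j⟩ ⟨i', j'⟩ ⟨h1, h2⟩ hc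
        simp only [Finset.coe_filter, Finset.mem_product, Finset.mem_range, Set.mem_ofPred_eq]
          at hc h1 h2 ⊢
        have := h.1 h1
        omega }
  else ⊥

theorem rowLen_ofRows {f : ℕ → ℕ} (hf : Antitone f) {n : ℕ} (hn : f n = 0) (i : ℕ) :
    (ofRows f).rowLen i = f i := by
  have h : Antitone f ∧ ∃ n, f n = 0 := ⟨hf, n, hn⟩
  have key : ∀ j, j < (ofRows f).rowLen i ↔ j < f i := by
    intro j
    rw [← mem_iff_lt_rowLen, ← mem_cells, ofRows, dif_pos h]
    simp only [Finset.mem_filter, Finset.mem_product, Finset.mem_range, and_iff_right_iff_imp]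
    intro hj
    have h0 := hf (Nat.zero_le i)
    refine ⟨?_, by omega⟩
    by_contra! hlt
    have := hf hlt
    have := h.2.choose_spec
    omega
  exact le_antisymm (not_lt.mp fun h => absurd ((key _).mp h) (lt_irrefl _))
    (not_lt.mp fun h => absurd ((key _).mpr h) (lt_irrefl _))

@[simp]
theorem rowLen_bot (i : ℕ) : (⊥ : YoungDiagram).rowLen i = 0 := by
  by_contra h
  exact notMem_bot (i, 0) (mem_iff_lt_rowLen.mpr (Nat.pos_of_ne_zero h))

theorem rowLen_le_card (μ : YoungDiagram) (i : ℕ) : μ.rowLen i ≤ μ.card := by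
  rw [rowLen_eq_card]
  exact Finset.card_le_card (Finset.filter_subset _ _)

theorem rowLen_eq_zero_of_le (μ : YoungDiagram) {m n : ℕ} (h : μ.rowLen m = 0) (hmn : m ≤ n) :
    μ.rowLen n = 0 :=
  Nat.le_zero.mp (h ▸ μ.rowLen_anti m n hmn)

theorem card_eq_sum_rowLen (μ : YoungDiagram) {n : ℕ} (h : μ.rowLen n = 0) :
    μ.card = ∑ i ∈ Finset.range n, μ.rowLen i := by
  rw [YoungDiagram.card, Finset.card_eq_sum_card_fiberwise (f := Prod.fst) (t := Finset.range n)]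
  · exact Finset.sum_congr rfl fun i _ => (μ.rowLen_eq_card).symm
  · rintro ⟨i, j⟩ hc
    have hc' : j < μ.rowLen i := mem_iff_lt_rowLen.mp (by simpa using hc)
    rw [Finset.mem_coe, Finset.mem_range]
    by_contra! hlt
    have : μ.rowLen i = 0 := μ.rowLen_eq_zero_of_le h hlt
    omega

/-- Otherwise the first column alone would have `μ.card + 1` cells. Hence a determinant of size |μ|
is large enough for Jacobi–Trudi. -/
theorem rowLen_card (μ : YoungDiagram) : μ.rowLen μ.card = 0 := by
  by_contra h
  have hsub : (Finset.range (μ.card + 1)).image (fun i => (i, 0)) ⊆ μ.cells := by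
    intro c hc
    obtain ⟨i, hi, rfl⟩ := Finset.mem_image.mp hc
    rw [mem_cells, mem_iff_lt_rowLen]
    have := μ.rowLen_anti i μ.card (Nat.lt_succ_iff.mp (Finset.mem_range.mp hi))
    omega
  have := Finset.card_le_card hsub
  rw [Finset.card_image_of_injective _ fun a b hab => (Prod.ext_iff.mp hab).1,
    Finset.card_range] at this
  exact absurd this (by simp)

theorem card_eq_zero_iff {μ : YoungDiagram} : μ.card = 0 ↔ μ = ⊥ := by
  rw [YoungDiagram.card, Finset.card_eq_zero, ← cells_bot]
  exact ⟨fun h => YoungDiagram.ext h, fun h => h ▸ rfl⟩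

theorem finite_card_eq (n : ℕ) : {μ : YoungDiagram | μ.card = n}.Finite := by
  refine Set.Finite.subset (Set.Finite.preimage (f := YoungDiagram.cells)
    (fun μ _ ν _ h => YoungDiagram.ext h)
    (Finset.finite_toSet (Finset.range n ×ˢ Finset.range n).powerset)) ?_
  rintro μ (rfl : μ.card = n)
  rw [Set.mem_preimage, Finset.mem_coe, Finset.mem_powerset]
  rintro ⟨i, j⟩ hc
  have hc' : j < μ.rowLen i := mem_iff_lt_rowLen.mp (by simpa using hc)
  have h1 := μ.rowLen_le_card i
  rw [Finset.mem_product, Finset.mem_range, Finset.mem_range]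
  refine ⟨?_, by omega⟩
  by_contra! hlt
  have : μ.rowLen i = 0 := μ.rowLen_eq_zero_of_le μ.rowLen_card hlt
  omega

/-- The Young diagrams with `n` cells. -/
noncomputable def ofCard (n : ℕ) : Finset YoungDiagram := (finite_card_eq n).toFinset

@[simp]
theorem mem_ofCard {n : ℕ} {μ : YoungDiagram} : μ ∈ ofCard n ↔ μ.card = n := by
  simp [ofCard]

theorem ofCard_zero : ofCard 0 = {⊥} := by
  ext μ
  rw [mem_ofCard, card_eq_zero_iff, Finset.mem_singleton]

/-- `μ.Interlaces ν` means that `ν / μ` is a horizontal strip: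
`ν₁ ≥ μ₁ ≥ ν₂ ≥ μ₂ ≥ ⋯`. -/
def Interlaces (μ ν : YoungDiagram) : Prop :=
  ∀ i, ν.rowLen (i + 1) ≤ μ.rowLen i ∧ μ.rowLen i ≤ ν.rowLen i

theorem Interlaces.le {μ ν : YoungDiagram} (h : μ.Interlaces ν) : μ ≤ ν :=
  le_iff_rowLen_le.mpr fun i => (h i).2

theorem Interlaces.card_le {μ ν : YoungDiagram} (h : μ.Interlaces ν) : μ.card ≤ ν.card :=
  Finset.card_le_card (cells_subset_iff.mpr h.le)

open Classical in
/-- The diagrams obtained from `ν` by removing a horizontal strip. -/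
noncomputable def removeStrips (ν : YoungDiagram) : Finset YoungDiagram :=
  ((Finset.range (ν.card + 1)).biUnion ofCard).filter fun μ => μ.Interlaces ν

@[simp]
theorem mem_removeStrips {μ ν : YoungDiagram} : μ ∈ removeStrips ν ↔ μ.Interlaces ν := by
  simp only [removeStrips, Finset.mem_filter, Finset.mem_biUnion, Finset.mem_range, mem_ofCard,
    exists_eq_right', and_iff_right_iff_imp]
  exact fun h => Nat.lt_succ_of_le h.card_le

open Classical in
/-- The diagrams obtained from `μ` by adding a horizontal strip with `r` cells. -/
noncomputable def addStrips (μ : YoungDiagram) (r : ℕ) : Finset YoungDiagram :=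
  (ofCard (μ.card + r)).filter fun ν => μ.Interlaces ν

@[simp]
theorem mem_addStrips {μ ν : YoungDiagram} {r : ℕ} :
    ν ∈ addStrips μ r ↔ ν.card = μ.card + r ∧ μ.Interlaces ν := by
  simp [addStrips]

/-- The local rule: given `μ` and `ν` with horizontal strips `l / μ` and `l / ν`, the diagram `κ`
with `κᵢ + lᵢ₊₁ = max μᵢ₊₁ νᵢ₊₁ + min μᵢ νᵢ`. -/
noncomputable def localDown (μ ν l : YoungDiagram) : YoungDiagram :=
  ofRows fun i => max (μ.rowLen (i + 1)) (ν.rowLen (i + 1)) + min (μ.rowLen i) (ν.rowLen i) -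
    l.rowLen (i + 1)

/-- The inverse of the local rule: given `μ` and `ν` with horizontal strips `μ / κ` and `ν / κ`, the
diagram `l` with `κᵢ + lᵢ₊₁ = max μᵢ₊₁ νᵢ₊₁ + min μᵢ νᵢ` and `l₀ = max μ₀ ν₀ + k`. -/
noncomputable def localUp (μ ν κ : YoungDiagram) (k : ℕ) : YoungDiagram :=
  ofRows fun i => match i with
    | 0 => max (μ.rowLen 0) (ν.rowLen 0) + k
    | i + 1 => max (μ.rowLen (i + 1)) (ν.rowLen (i + 1)) + min (μ.rowLen i) (ν.rowLen i) -
        κ.rowLen i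

/-! ### The local rule for horizontal strips. -/

section LocalRule

variable {μ ν l κ : YoungDiagram} {k : ℕ}

/-- The row length l_{i+1} lies between max(μ_{i+1}, ν_{i+1}) and min(μ_i, ν_i), and κ_i is its
mirror image in this interval. So the truncated subtraction is a true one and the new rows decrease.
-/
theorem rowLen_localDown (hμ : μ.Interlaces l) (hν : ν.Interlaces l) (i : ℕ) :
    (localDown μ ν l).rowLen i = max (μ.rowLen (i + 1)) (ν.rowLen (i + 1)) +
      min (μ.rowLen i) (ν.rowLen i) - l.rowLen (i + 1) := by
  have anti : Antitone fun i => max (μ.rowLen (i + 1)) (ν.rowLen (i + 1)) +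
      min (μ.rowLen i) (ν.rowLen i) - l.rowLen (i + 1) := by
    refine antitone_nat_of_succ_le fun i => ?_
    have := hμ i
    have := hν i
    have := hμ (i + 1)
    have := hν (i + 1)
    have := hμ (i + 1 + 1)
    have := hν (i + 1 + 1)
    omega
  refine rowLen_ofRows anti (n := μ.card) ?_ i
  have h1 := μ.rowLen_card
  have h2 := μ.rowLen_eq_zero_of_le h1 (Nat.le_succ _)
  have := hμ μ.card
  have := hν (μ.card + 1)
  have := hν (μ.card)
  simp only [h1, h2, zero_le, inf_of_le_left, sup_of_le_right, add_zero]
  simp only [Nat.succ_eq_add_one] at h2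
  omega

/-- The same reflection carries κ_i to l_{i+1}. Row 0 of l is bounded only from below, whence the
free parameter `k`. -/
theorem rowLen_localUp (hμ : κ.Interlaces μ) (hν : κ.Interlaces ν) (i : ℕ) :
    (localUp μ ν κ k).rowLen (i + 1) = max (μ.rowLen (i + 1)) (ν.rowLen (i + 1)) +
      min (μ.rowLen i) (ν.rowLen i) - κ.rowLen i ∧
    (localUp μ ν κ k).rowLen 0 = max (μ.rowLen 0) (ν.rowLen 0) + k := by
  let f : ℕ → ℕ := fun i => match i with
    | 0 => max (μ.rowLen 0) (ν.rowLen 0) + k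
    | i + 1 => max (μ.rowLen (i + 1)) (ν.rowLen (i + 1)) + min (μ.rowLen i) (ν.rowLen i) -
        κ.rowLen i
  have anti : Antitone f := by
    refine antitone_nat_of_succ_le fun i => ?_
    have := hμ i
    have := hν i
    have := hμ (i + 1)
    have := hν (i + 1)
    cases i with
    | zero => simp only [f]; omega
    | succ i =>
      have := hμ i
      have := hν i
      simp only [f]; omega
  have hn : f (μ.card + ν.card + 1) = 0 := by
    have h1 := μ.rowLen_eq_zero_of_le μ.rowLen_card (Nat.le_add_right _ ν.card)
    have h2 := μ.rowLen_eq_zero_of_le h1 (Nat.le_succ _)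
    have h3 := ν.rowLen_eq_zero_of_le ν.rowLen_card (Nat.le_add_left _ μ.card)
    have h4 := ν.rowLen_eq_zero_of_le h3 (Nat.le_succ _)
    simp only [Nat.succ_eq_add_one] at h2 h4
    simp only [f]
    omega
  have key := rowLen_ofRows anti (n := μ.card + ν.card + 1) hn
  exact ⟨key (i + 1), key 0⟩

theorem localDown_interlaces (hμ : μ.Interlaces l) (hν : ν.Interlaces l) :
    (localDown μ ν l).Interlaces μ ∧ (localDown μ ν l).Interlaces ν := by
  refine ⟨fun i => ?_, fun i => ?_⟩ <;>
  · rw [rowLen_localDown hμ hν]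
    have := hμ i
    have := hν i
    have := hμ (i + 1)
    have := hν (i + 1)
    omega

theorem interlaces_localUp (hμ : κ.Interlaces μ) (hν : κ.Interlaces ν) :
    μ.Interlaces (localUp μ ν κ k) ∧ ν.Interlaces (localUp μ ν κ k) := by
  refine ⟨fun i => ?_, fun i => ?_⟩ <;>
  · rw [(rowLen_localUp hμ hν i).1]
    have := hμ i
    have := hν i
    cases i with
    | zero => rw [(rowLen_localUp hμ hν 0).2]; omega
    | succ i =>
      rw [(rowLen_localUp hμ hν i).1]
      have := hμ i
      have := hν i
      omega

theorem localDown_localUp (hμ : κ.Interlaces μ) (hν : κ.Interlaces ν) :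
    localDown μ ν (localUp μ ν κ k) = κ := by
  refine ext_rowLen fun i => ?_
  obtain ⟨h1, h2⟩ := interlaces_localUp (k := k) hμ hν
  rw [rowLen_localDown h1 h2, (rowLen_localUp hμ hν i).1]
  have := hμ i
  have := hν i
  omega

theorem localUp_localDown (hμ : μ.Interlaces l) (hν : ν.Interlaces l) :
    localUp μ ν (localDown μ ν l) (l.rowLen 0 - max (μ.rowLen 0) (ν.rowLen 0)) = l := by
  obtain ⟨h1, h2⟩ := localDown_interlaces hμ hν
  refine ext_rowLen fun i => ?_
  have := hμ 0
  have := hν 0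
  cases i with
  | zero => rw [(rowLen_localUp h1 h2 0).2]; omega
  | succ i =>
    rw [(rowLen_localUp h1 h2 i).1, rowLen_localDown hμ hν]
    have := hμ i
    have := hν i
    have := hμ (i + 1)
    have := hν (i + 1)
    omega

theorem card_localUp (hμ : κ.Interlaces μ) (hν : κ.Interlaces ν) :
    (localUp μ ν κ k).card + κ.card = μ.card + ν.card + k := by
  set l := localUp μ ν κ k with hl
  obtain ⟨-, h0⟩ := rowLen_localUp (k := k) hμ hν 0
  set n := μ.card + ν.card with hn
  have e1 : μ.rowLen n = 0 := μ.rowLen_eq_zero_of_le μ.rowLen_card (Nat.le_add_right _ ν.card)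
  have e2 : ν.rowLen n = 0 := ν.rowLen_eq_zero_of_le ν.rowLen_card (Nat.le_add_left _ μ.card)
  have e3 : κ.rowLen n = 0 := by
    have := hμ n
    omega
  have e4 : l.rowLen (n + 1) = 0 := by
    have := (rowLen_localUp (k := k) hμ hν n).1
    have := μ.rowLen_anti n (n + 1) (Nat.le_succ n)
    have := ν.rowLen_anti n (n + 1) (Nat.le_succ n)
    rw [hl]
    omega
  -- Since max + min is the sum, adding up the local relations telescopes to a single boundary term,
  -- which vanishes at m = |μ| + |ν|.
  have key : ∀ m, ∑ i ∈ Finset.range (m + 1), l.rowLen i + ∑ i ∈ Finset.range m, κ.rowLen i =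
      ∑ i ∈ Finset.range m, μ.rowLen i + ∑ i ∈ Finset.range m, ν.rowLen i + k +
        max (μ.rowLen m) (ν.rowLen m) := by
    intro m
    induction m with
    | zero => simp only [zero_add, Finset.sum_range_one, Finset.sum_range_zero, hl, h0]; omega
    | succ m ih =>
      rw [Finset.sum_range_succ (n := m + 1), Finset.sum_range_succ (fun i => κ.rowLen i) m,
        Finset.sum_range_succ (fun i => μ.rowLen i) m,
        Finset.sum_range_succ (fun i => ν.rowLen i) m, hl, (rowLen_localUp hμ hν m).1, ← hl]
      have := hμ m
      have := hν m
      omega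
  have := key n
  rw [← card_eq_sum_rowLen l e4, ← card_eq_sum_rowLen κ e3, ← card_eq_sum_rowLen μ e1,
    ← card_eq_sum_rowLen ν e2] at this
  omega

theorem card_localDown (hμ : μ.Interlaces l) (hν : ν.Interlaces l) :
    l.card + (localDown μ ν l).card =
      μ.card + ν.card + (l.rowLen 0 - max (μ.rowLen 0) (ν.rowLen 0)) := by
  obtain ⟨h1, h2⟩ := localDown_interlaces hμ hν
  have := card_localUp (k := l.rowLen 0 - max (μ.rowLen 0) (ν.rowLen 0)) h1 h2
  rwa [localUp_localDown hμ hν] at this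

/-- Summation over all ways to add a horizontal strip and then remove one, rewritten by the local
rule as a summation over all ways to remove a horizontal strip and then add one. -/
theorem sum_addStrips_removeStrips {M : Type*} [AddCommMonoid M] (ν : YoungDiagram) (r : ℕ)
    (f : ℕ → YoungDiagram → M) :
    ∑ l ∈ addStrips ν r, ∑ μ ∈ removeStrips l, f (l.card - μ.card) μ =
      ∑ κ ∈ removeStrips ν, ∑ k ∈ Finset.range (r + 1), ∑ μ ∈ addStrips κ (r - k),
        f (k + (ν.card - κ.card)) μ := by
  simp only [Finset.sum_sigma']
  -- The reflection forgets the first row of `l`; its excess over max(μ₀, ν₀) is kept as k. Counting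
  -- cells gives |μ| = |κ| + r - k, so k ≤ r.
  refine Finset.sum_bij'
    (fun p _ => ⟨localDown p.2 ν p.1, ⟨p.1.rowLen 0 - max (p.2.rowLen 0) (ν.rowLen 0), p.2⟩⟩)
    (fun q _ => ⟨localUp q.2.2 ν q.1 q.2.1, q.2.2⟩) ?_ ?_ ?_ ?_ ?_
  · rintro ⟨l, μ⟩ h
    simp only [Finset.mem_sigma, mem_addStrips, mem_removeStrips, Finset.mem_range] at h ⊢
    obtain ⟨⟨hc, hν⟩, hμ⟩ := h
    obtain ⟨h1, h2⟩ := localDown_interlaces hμ hν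
    have := card_localDown hμ hν
    have := h1.card_le
    have := h2.card_le
    exact ⟨h2, by omega, by omega, h1⟩
  · rintro ⟨κ, k, μ⟩ h
    simp only [Finset.mem_sigma, mem_addStrips, mem_removeStrips, Finset.mem_range] at h ⊢
    obtain ⟨hν, hk, hc, hμ⟩ := h
    obtain ⟨h1, h2⟩ := interlaces_localUp (k := k) hμ hν
    have := card_localUp (k := k) hμ hν
    exact ⟨⟨by omega, h2⟩, h1⟩
  · rintro ⟨l, μ⟩ h
    simp only [Finset.mem_sigma, mem_addStrips, mem_removeStrips] at h
    simp only [localUp_localDown h.2 h.1.2]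
  · rintro ⟨κ, k, μ⟩ h
    simp only [Finset.mem_sigma, mem_addStrips, mem_removeStrips, Finset.mem_range] at h
    simp only [localDown_localUp h.2.2.2 h.1, (rowLen_localUp h.2.2.2 h.1 0).2,
      add_tsub_cancel_left]
  · rintro ⟨l, μ⟩ h
    simp only [Finset.mem_sigma, mem_addStrips, mem_removeStrips] at h
    obtain ⟨⟨hc, hν⟩, hμ⟩ := h
    have := card_localDown hμ hν
    have := (localDown_interlaces hμ hν).2.card_le
    have := hμ.card_le
    congr 1
    dsimp only
    omega

end LocalRule

end YoungDiagram

/-! ### Tableaux with bounded entries, and removal of the largest entry. -/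

open YoungDiagram SemistandardYoungTableau Filter Topology MvPowerSeries

namespace SemistandardYoungTableau

variable {μ ν : YoungDiagram}

theorem finite_bounded (N : ℕ) (μ : YoungDiagram) :
    {T : SemistandardYoungTableau μ | ∀ i j, (i, j) ∈ μ → T i j < N}.Finite := by
  -- The cut-off at `N` only makes the map total; it changes nothing on tableaux with entries below
  -- `N`.
  refine Set.Finite.of_injOn (t := Set.univ) (f := fun T (c : μ.cells) =>
    (⟨min (T c.1.1 c.1.2) N, Nat.lt_succ_of_le (min_le_right _ _)⟩ : Fin (N + 1)))
    (fun _ _ => Set.mem_univ _) ?_ Set.finite_univ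
  intro T hT T' hT' h
  refine SemistandardYoungTableau.ext fun i j => ?_
  by_cases hc : (i, j) ∈ μ
  · have h1 := Fin.val_eq_of_eq (congrFun h ⟨(i, j), (YoungDiagram.mem_cells _).mpr hc⟩)
    have h2 := hT i j hc
    have h3 := hT' i j hc
    dsimp only at h1
    omega
  · rw [T.zeros hc, T'.zeros hc]

/-- The semistandard tableaux of shape `μ` with entries less than `N`. -/
noncomputable def bounded (N : ℕ) (μ : YoungDiagram) : Finset (SemistandardYoungTableau μ) :=
  (finite_bounded N μ).toFinset

@[simp]
theorem mem_bounded {N : ℕ} {T : SemistandardYoungTableau μ} :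
    T ∈ bounded N μ ↔ ∀ i j, (i, j) ∈ μ → T i j < N := by
  simp [bounded]

/-- The diagram of the cells with entry less than `N`. -/
def innerShape (T : SemistandardYoungTableau μ) (N : ℕ) : YoungDiagram where
  cells := μ.cells.filter fun c => T c.1 c.2 < N
  isLowerSet := by
    rintro ⟨i, j⟩ ⟨i', j'⟩ ⟨h1, h2⟩ hc
    simp only [Finset.coe_filter, YoungDiagram.mem_cells, Set.mem_ofPred_eq] at hc h1 h2 ⊢
    refine ⟨μ.up_left_mem h1 h2 hc.1, ?_⟩
    have e1 := T.col_weak h1 (μ.up_left_mem le_rfl h2 hc.1)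
    have e2 := T.row_weak_of_le h2 hc.1
    exact (e1.trans e2).trans_lt hc.2

theorem mem_innerShape {T : SemistandardYoungTableau μ} {N : ℕ} {c : ℕ × ℕ} :
    c ∈ T.innerShape N ↔ c ∈ μ ∧ T c.1 c.2 < N := by
  rw [← YoungDiagram.mem_cells, innerShape, Finset.mem_filter, YoungDiagram.mem_cells]

/-- Columns are strict, so the largest possible entry `N` occurs at most once in a column: a cell
with another cell below it has an entry less than `N`. -/
theorem innerShape_interlaces {T : SemistandardYoungTableau μ} {N : ℕ}
    (hT : ∀ i j, (i, j) ∈ μ → T i j < N + 1) : (T.innerShape N).Interlaces μ := by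
  refine fun i => ⟨le_of_forall_lt fun j hj => ?_, le_of_forall_lt fun j hj => ?_⟩
  · rw [← YoungDiagram.mem_iff_lt_rowLen] at hj ⊢
    have := T.col_strict (Nat.lt_add_one i) hj
    have := hT _ _ hj
    exact mem_innerShape.mpr ⟨μ.up_left_mem (Nat.le_succ i) le_rfl hj, by dsimp only; omega⟩
  · rw [← YoungDiagram.mem_iff_lt_rowLen] at hj ⊢
    exact (mem_innerShape.mp hj).1

/-- The restriction of a tableau to a smaller diagram. -/
def restrict (T : SemistandardYoungTableau μ) (h : ν ≤ μ) : SemistandardYoungTableau ν where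
  entry i j := if (i, j) ∈ ν then T i j else 0
  row_weak' := by
    intro i j1 j2 hj hc
    rw [if_pos hc, if_pos (ν.up_left_mem le_rfl hj.le hc)]
    exact T.row_weak hj (h hc)
  col_strict' := by
    intro i1 i2 j hi hc
    rw [if_pos hc, if_pos (ν.up_left_mem hi.le le_rfl hc)]
    exact T.col_strict hi (h hc)
  zeros' := fun hc => if_neg hc

theorem restrict_apply (T : SemistandardYoungTableau μ) (h : ν ≤ μ) (i j : ℕ) :
    T.restrict h i j = if (i, j) ∈ ν then T i j else 0 := rfl

/-- The extension of a tableau with entries less than `N` by entries `N` along a horizontal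
strip. -/
def extend (T : SemistandardYoungTableau μ) (h : μ.Interlaces ν) {N : ℕ}
    (hT : ∀ i j, (i, j) ∈ μ → T i j < N) : SemistandardYoungTableau ν where
  entry i j := if (i, j) ∈ μ then T i j else if (i, j) ∈ ν then N else 0
  row_weak' := by
    intro i j1 j2 hj hc
    by_cases h2 : (i, j2) ∈ μ
    · rw [if_pos h2, if_pos (μ.up_left_mem le_rfl hj.le h2)]
      exact T.row_weak hj h2
    · rw [if_neg h2, if_pos hc]
      split_ifs with h1 h3
      · exact (hT _ _ h1).le
      · exact le_rfl
      · exact Nat.zero_le _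
  col_strict' := by
    intro i1 i2 j hi hc
    -- By interlacing, any cell of `ν` with a cell of `ν` below it is already in `μ`, so no column
    -- receives two entries `N`.
    have h1 : (i1, j) ∈ μ := by
      rw [YoungDiagram.mem_iff_lt_rowLen] at hc ⊢
      exact hc.trans_le ((ν.rowLen_anti _ _ hi).trans (h i1).1)
    rw [if_pos h1]
    split_ifs with h2
    · exact T.col_strict hi h2
    · exact hT _ _ h1
  zeros' := by
    intro i j hc
    rw [if_neg fun h1 => hc (h.le h1), if_neg hc]

theorem extend_apply (T : SemistandardYoungTableau μ) (h : μ.Interlaces ν) {N : ℕ}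
    (hT : ∀ i j, (i, j) ∈ μ → T i j < N) (i j : ℕ) :
    T.extend h hT i j = if (i, j) ∈ μ then T i j else if (i, j) ∈ ν then N else 0 := rfl

end SemistandardYoungTableau

/-! ### Schur polynomials in finitely many variables. -/

section FiniteSchur

variable {A : Type*} [CommRing A]

/-- The Schur polynomial of shape `μ` in the `N` variables `x₀, …, x_{N-1}`. -/
noncomputable def schurEval (x : ℕ → A) (N : ℕ) (μ : YoungDiagram) : A :=
  ∑ T ∈ bounded N μ, ∏ c ∈ μ.cells, x (T c.1 c.2)

theorem schurEval_bot (x : ℕ → A) (N : ℕ) : schurEval x N ⊥ = 1 := by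
  have : bounded N ⊥ = {default} := by
    ext T
    rw [Finset.mem_singleton]
    refine ⟨fun _ => SemistandardYoungTableau.ext fun i j => ?_, fun _ => ?_⟩
    · rw [T.zeros (notMem_bot _), zeros _ (notMem_bot _)]
    · exact mem_bounded.mpr fun i j h => absurd h (notMem_bot _)
  rw [schurEval, this, Finset.sum_singleton, cells_bot, Finset.prod_empty]

theorem schurEval_zero (x : ℕ → A) {μ : YoungDiagram} (h : μ ≠ ⊥) : schurEval x 0 μ = 0 := by
  have : bounded 0 μ = ∅ := by
    refine Finset.eq_empty_of_forall_notMem fun T hT => h (card_eq_zero_iff.mp ?_)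
    rw [YoungDiagram.card, Finset.card_eq_zero]
    exact Finset.eq_empty_of_forall_notMem fun c hc =>
      absurd (mem_bounded.mp hT c.1 c.2 ((mem_cells _).mp hc)) (Nat.not_lt_zero _)
  rw [schurEval, this, Finset.sum_empty]

/-- The branching rule: the Schur polynomial in `N + 1` variables, expanded in the last variable. -/
theorem schurEval_succ (x : ℕ → A) (N : ℕ) (ν : YoungDiagram) :
    schurEval x (N + 1) ν =
      ∑ μ ∈ removeStrips ν, x N ^ (ν.card - μ.card) * schurEval x N μ := by
  classical
  -- Tableaux are grouped by the shape of their entries below `N`; the remaining cells form a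
  -- horizontal strip filled with `N`.
  rw [schurEval, ← Finset.sum_fiberwise_of_maps_to (t := removeStrips ν)
    (g := fun T => T.innerShape N)
    fun T hT => mem_removeStrips.mpr (innerShape_interlaces (mem_bounded.mp hT))]
  refine Finset.sum_congr rfl fun μ hμ => ?_
  rw [mem_removeStrips] at hμ
  rw [schurEval, Finset.mul_sum]
  symm
  refine Finset.sum_bij' (fun S hS => S.extend hμ (mem_bounded.mp hS))
    (fun T _ => T.restrict hμ.le) ?_ ?_ ?_ ?_ ?_
  · intro S hS
    rw [mem_bounded] at hS
    rw [Finset.mem_filter, mem_bounded]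
    refine ⟨fun i j hc => ?_, SetLike.ext ?_⟩
    · rw [extend_apply, if_pos hc]
      split_ifs with h
      · exact (hS i j h).trans (Nat.lt_succ_self N)
      · exact Nat.lt_succ_self N
    · rintro ⟨i, j⟩
      rw [mem_innerShape, extend_apply]
      by_cases h : (i, j) ∈ μ
      · simp [h, hμ.le h, hS i j h]
      · by_cases h' : (i, j) ∈ ν <;> simp [h, h']
  · intro T hT
    rw [Finset.mem_filter] at hT
    obtain ⟨-, rfl⟩ := hT
    rw [mem_bounded]
    intro i j hc
    rw [restrict_apply, if_pos hc]
    exact (mem_innerShape.mp hc).2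
  · intro S hS
    refine SemistandardYoungTableau.ext fun i j => ?_
    rw [restrict_apply, extend_apply]
    split_ifs with h
    · rfl
    · exact (S.zeros h).symm
  · intro T hT
    rw [Finset.mem_filter, mem_bounded] at hT
    obtain ⟨hb, rfl⟩ := hT
    refine SemistandardYoungTableau.ext fun i j => ?_
    rw [extend_apply, restrict_apply]
    by_cases h : (i, j) ∈ T.innerShape N
    · rw [if_pos h, if_pos h]
    · rw [if_neg h]
      split_ifs with h'
      · have h1 := hb i j h'
        have h2 : ¬ T i j < N := fun h2 => h (mem_innerShape.mpr ⟨h', h2⟩)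
        omega
      · exact (T.zeros h').symm
  · intro S hS
    have hsub : μ.cells ⊆ ν.cells := cells_subset_iff.mpr hμ.le
    rw [← Finset.prod_sdiff hsub, ← Finset.card_sdiff_of_subset hsub]
    congr 1
    · rw [Finset.prod_congr rfl (g := fun _ => x N), Finset.prod_const]
      intro c hc
      rw [Finset.mem_sdiff, mem_cells, mem_cells] at hc
      rw [extend_apply, if_neg hc.2, if_pos hc.1]
    · refine Finset.prod_congr rfl fun c hc => ?_
      rw [extend_apply, if_pos ((mem_cells _).mp hc)]

end FiniteSchur

/-! ### Newton, Pieri, Cauchy and Jacobi–Trudi in finitely many variables. -/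

section FiniteIdentities

variable {A : Type*} [CommRing A] {ι : Type*}

/-- The complete homogeneous symmetric polynomial of degree `n` in the variables `w a`, `a ∈ S`. -/
noncomputable def completeEval (S : Finset ι) (w : ι → A) (n : ℕ) : A :=
  PowerSeries.coeff n (∏ a ∈ S, PowerSeries.mk fun k => w a ^ k)

theorem completeEval_empty (w : ι → A) (n : ℕ) :
    completeEval ∅ w n = if n = 0 then 1 else 0 := by
  rw [completeEval, Finset.prod_empty, PowerSeries.coeff_one]

theorem completeEval_zero (S : Finset ι) (w : ι → A) : completeEval S w 0 = 1 := by
  rw [completeEval, PowerSeries.coeff_zero_eq_constantCoeff_apply, map_prod]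
  refine Finset.prod_eq_one fun a _ => ?_
  rw [← PowerSeries.coeff_zero_eq_constantCoeff_apply, PowerSeries.coeff_mk, pow_zero]

theorem completeEval_insert [DecidableEq ι] {S : Finset ι} {a : ι} (ha : a ∉ S) (w : ι → A)
    (n : ℕ) : completeEval (insert a S) w n =
      ∑ k ∈ Finset.range (n + 1), w a ^ k * completeEval S w (n - k) := by
  rw [completeEval, Finset.prod_insert ha, PowerSeries.coeff_mul,
    Finset.Nat.sum_antidiagonal_eq_sum_range_succ_mk]
  simp only [PowerSeries.coeff_mk, completeEval]

theorem completeEval_range_succ (w : ℕ → A) (N n : ℕ) :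
    completeEval (Finset.range (N + 1)) w n =
      ∑ k ∈ Finset.range (n + 1), w N ^ k * completeEval (Finset.range N) w (n - k) := by
  rw [Finset.range_add_one, completeEval_insert Finset.notMem_range_self]

theorem completeEval_mul_const (S : Finset ι) (w : ι → A) (c : A) (n : ℕ) :
    completeEval S (fun a => w a * c) n = c ^ n * completeEval S w n := by
  rw [completeEval, completeEval, ← PowerSeries.coeff_rescale,
    map_prod (PowerSeries.rescale c)]
  congr 1
  refine Finset.prod_congr rfl fun a _ => ?_
  ext k
  rw [PowerSeries.coeff_rescale, PowerSeries.coeff_mk, PowerSeries.coeff_mk, mul_pow, mul_comm]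

/-- Newton's identities for the complete homogeneous symmetric polynomials. -/
theorem succ_mul_completeEval (S : Finset ι) (w : ι → A) (n : ℕ) :
    ((n + 1 : ℕ) : A) * completeEval S w (n + 1) =
      ∑ p ∈ Finset.HasAntidiagonal.antidiagonal n,
        completeEval S w p.1 * ∑ a ∈ S, w a ^ (p.2 + 1) := by
  classical
  -- The geometric series is 1/(1 - w z), with logarithmic derivative w/(1 - w z); each coefficient
  -- is a sum of k + 1 equal terms.
  have single : ∀ a, PowerSeries.derivative A (PowerSeries.mk fun k => w a ^ k) =
      (PowerSeries.mk fun k => w a ^ k) * PowerSeries.mk fun k => w a ^ (k + 1) := by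
    intro a
    ext k
    rw [PowerSeries.coeff_derivative, PowerSeries.coeff_mul, PowerSeries.coeff_mk]
    have : ∀ p ∈ Finset.HasAntidiagonal.antidiagonal k,
        PowerSeries.coeff p.1 (PowerSeries.mk fun k => w a ^ k) *
        PowerSeries.coeff p.2 (PowerSeries.mk fun k => w a ^ (k + 1)) = w a ^ (k + 1) := by
      intro p hp
      rw [PowerSeries.coeff_mk, PowerSeries.coeff_mk, ← pow_add,
        ← Finset.HasAntidiagonal.mem_antidiagonal.mp hp,
        add_assoc]
    rw [Finset.sum_congr rfl this, Finset.sum_const, Finset.Nat.card_antidiagonal, nsmul_eq_mul,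
      mul_comm]
    push_cast
    rfl
  have key : PowerSeries.derivative A (∏ a ∈ S, PowerSeries.mk fun k => w a ^ k) =
      (∏ a ∈ S, PowerSeries.mk fun k => w a ^ k) *
        PowerSeries.mk fun k => ∑ a ∈ S, w a ^ (k + 1) := by
    induction S using Finset.induction_on with
    | empty =>
      have : (PowerSeries.mk fun k => ∑ a ∈ (∅ : Finset ι), w a ^ (k + 1)) = 0 := by
        ext k
        simp
      rw [this, Finset.prod_empty, mul_zero, Derivation.map_one_eq_zero]
    | insert a S ha ih =>
      have : (PowerSeries.mk fun k => ∑ a ∈ insert a S, w a ^ (k + 1)) =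
          (PowerSeries.mk fun k => w a ^ (k + 1)) +
            PowerSeries.mk fun k => ∑ a ∈ S, w a ^ (k + 1) := by
        ext k
        simp [Finset.sum_insert ha]
      rw [Finset.prod_insert ha, Derivation.leibniz, ih, single, this, smul_eq_mul, smul_eq_mul]
      ring
  have := congrArg (PowerSeries.coeff n) key
  rw [PowerSeries.coeff_derivative, PowerSeries.coeff_mul] at this
  simp only [PowerSeries.coeff_mk] at this
  rw [mul_comm]
  push_cast
  exact this

/-- Pieri's rule. -/
theorem sum_addStrips_schurEval (x : ℕ → A) (N : ℕ) (ν : YoungDiagram) (r : ℕ) :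
    ∑ l ∈ addStrips ν r, schurEval x N l =
      completeEval (Finset.range N) x r * schurEval x N ν := by
  induction N generalizing ν r with
  | zero =>
    rw [Finset.range_zero, completeEval_empty]
    classical
    have h0 : ∀ l, schurEval x 0 l = if l = ⊥ then 1 else 0 := by
      intro l
      split_ifs with h
      · rw [h, schurEval_bot]
      · exact schurEval_zero x h
    simp only [h0]
    rw [Finset.sum_ite_eq']
    have : (⊥ : YoungDiagram) ∈ addStrips ν r ↔ ν = ⊥ ∧ r = 0 := by
      rw [mem_addStrips, card_eq_zero_iff.mpr rfl]
      constructor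
      · rintro ⟨h, -⟩
        exact ⟨card_eq_zero_iff.mp (by omega), by omega⟩
      · rintro ⟨rfl, rfl⟩
        exact ⟨by rw [card_eq_zero_iff.mpr rfl], fun i => by simp⟩
    simp only [this]
    by_cases h1 : ν = ⊥ <;> by_cases h2 : r = 0 <;> simp [h1, h2]
  | succ N ih =>
    simp only [schurEval_succ]
    -- After the exchange the exponent splits: x_N^k with h_{r-k} rebuilds h_r in `N + 1` variables,
    -- and x_N^{|ν/κ|} rebuilds s_ν by branching.
    rw [sum_addStrips_removeStrips ν r fun a μ => x N ^ a * schurEval x N μ,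
      completeEval_range_succ, Finset.sum_mul_sum, Finset.sum_comm]
    refine Finset.sum_congr rfl fun k _ => Finset.sum_congr rfl fun κ _ => ?_
    rw [← Finset.mul_sum, ih, pow_add]
    ring

/-- The degree `n` part of the Cauchy identity in finitely many variables. -/
theorem sum_ofCard_schurEval_mul_schurEval (x y : ℕ → A) (N M n : ℕ) :
    ∑ l ∈ ofCard n, schurEval x N l * schurEval y M l =
      completeEval (Finset.range N ×ˢ Finset.range M) (fun p => x p.1 * y p.2) n := by
  induction M generalizing n with
  | zero =>
    rw [Finset.range_zero, Finset.product_empty, completeEval_empty]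
    split_ifs with h
    · rw [h, ofCard_zero, Finset.sum_singleton, schurEval_bot, schurEval_bot, mul_one]
    · refine Finset.sum_eq_zero fun l hl => ?_
      rw [mem_ofCard] at hl
      rw [schurEval_zero y fun h' => h (by rw [← hl, card_eq_zero_iff.mpr h']), mul_zero]
  | succ M ih =>
    -- The pairs (i, M) split off as a separate factor, which contributes h_r(x y_M) = y_M^r h_r(x).
    have e1 : completeEval (Finset.range N ×ˢ Finset.range (M + 1)) (fun p => x p.1 * y p.2) n =
        ∑ r ∈ Finset.range (n + 1), y M ^ r * completeEval (Finset.range N) x r *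
          completeEval (Finset.range N ×ˢ Finset.range M) (fun p => x p.1 * y p.2) (n - r) := by
      simp only [← completeEval_mul_const]
      rw [completeEval, Finset.prod_product_right, Finset.prod_range_succ, mul_comm,
        ← Finset.prod_product_right (f := fun p : ℕ × ℕ => PowerSeries.mk fun k =>
          (x p.1 * y p.2) ^ k), PowerSeries.coeff_mul,
        Finset.Nat.sum_antidiagonal_eq_sum_range_succ_mk]
      rfl
    rw [e1]
    simp only [schurEval_succ, Finset.mul_sum, ← ih]
    -- Pieri's rule, read backwards: h_r s_ν becomes a sum over the l with l/ν a strip of size r.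
    -- Summed over r and ν, this is the branching rule for s_l(y).
    have e2 : ∀ r, ∑ ν ∈ ofCard (n - r), y M ^ r * completeEval (Finset.range N) x r *
        (schurEval x N ν * schurEval y M ν) =
        ∑ ν ∈ ofCard (n - r), ∑ l ∈ addStrips ν r,
          schurEval x N l * (y M ^ (l.card - ν.card) * schurEval y M ν) := by
      intro r
      refine Finset.sum_congr rfl fun ν _ => ?_
      rw [Finset.sum_congr rfl (g := fun l => schurEval x N l * (y M ^ r * schurEval y M ν)),
        ← Finset.sum_mul, sum_addStrips_schurEval]
      · ring
      · intro l hl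
        rw [(mem_addStrips.mp hl).1, add_tsub_cancel_left]
    simp only [e2, Finset.sum_sigma']
    refine Finset.sum_bij' (fun p _ => ⟨p.1.card - p.2.card, p.2, p.1⟩)
      (fun q _ => ⟨q.2.2, q.2.1⟩) ?_ ?_ ?_ ?_ ?_
    · rintro ⟨l, ν⟩ h
      simp only [Finset.mem_sigma, mem_ofCard, mem_removeStrips, mem_addStrips,
        Finset.mem_range] at h ⊢
      have := h.2.card_le
      exact ⟨by omega, by omega, by omega, h.2⟩
    · rintro ⟨r, ν, l⟩ h
      simp only [Finset.mem_sigma, mem_ofCard, mem_removeStrips, mem_addStrips,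
        Finset.mem_range] at h ⊢
      exact ⟨by omega, h.2.2.2⟩
    · rintro ⟨l, ν⟩ h
      rfl
    · rintro ⟨r, ν, l⟩ h
      simp only [Finset.mem_sigma, mem_addStrips] at h
      simp only [h.2.2.1, add_tsub_cancel_left]
    · rintro ⟨l, ν⟩ h
      rfl

/-- Complete homogeneous symmetric polynomials in `x₀, …, x_{N-1}`, with integral degrees. -/
noncomputable def completeInt (x : ℕ → A) (N : ℕ) (k : ℤ) : A :=
  if 0 ≤ k then completeEval (Finset.range N) x k.toNat else 0

theorem completeInt_of_neg (x : ℕ → A) (N : ℕ) {k : ℤ} (hk : k < 0) : completeInt x N k = 0 :=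
  if_neg (not_le.mpr hk)

theorem completeInt_natCast (x : ℕ → A) (N k : ℕ) :
    completeInt x N k = completeEval (Finset.range N) x k := by
  rw [completeInt, if_pos (Int.natCast_nonneg k), Int.toNat_natCast]

/-- This is (1 - x_N z) H_{N+1}(z) = H_N(z) for the generating series; the convention for negative
degrees makes it valid for every integer. -/
theorem completeInt_succ (x : ℕ → A) (N : ℕ) (k : ℤ) :
    completeInt x (N + 1) k = completeInt x N k + x N * completeInt x (N + 1) (k - 1) := by
  rcases lt_or_ge k 0 with hk | hk
  · rw [completeInt_of_neg _ _ hk, completeInt_of_neg _ _ hk, completeInt_of_neg _ _ (by omega),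
      mul_zero, add_zero]
  · lift k to ℕ using hk
    cases k with
    | zero =>
      rw [completeInt_of_neg (k := ((0 : ℕ) : ℤ) - 1) _ _ (by omega), completeInt_natCast,
        completeInt_natCast, completeEval_zero, completeEval_zero, mul_zero, add_zero]
    | succ k =>
      have : (((k + 1 : ℕ) : ℤ) - 1) = (k : ℤ) := by omega
      rw [this, completeInt_natCast, completeInt_natCast, completeInt_natCast,
        completeEval_range_succ, Finset.sum_range_succ', completeEval_range_succ x N k,
        Finset.mul_sum, add_comm]
      congr 1
      · rw [pow_zero, one_mul, tsub_zero]
      · refine Finset.sum_congr rfl fun i _ => ?_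
        rw [Nat.add_sub_add_right, pow_succ]
        ring

/-- By `completeInt_succ` the sum telescopes. With p = l_{i+1}, q = l_i and c = j - i, the two end
terms lie in rows i and i + 1 of the Jacobi–Trudi matrix. -/
theorem sum_Icc_completeInt (x : ℕ → A) (N : ℕ) (c : ℤ) {p q : ℕ} (hpq : p ≤ q) :
    ∑ b ∈ Finset.Icc p q, x N ^ (q - b) * completeInt x N (b + c) =
      completeInt x (N + 1) (q + c) - x N ^ (q - p + 1) * completeInt x (N + 1) (p + c - 1) := by
  induction q, hpq using Nat.le_induction with
  | base =>
    rw [Finset.Icc_self, Finset.sum_singleton, completeInt_succ x N (p + c)]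
    simp
  | succ q hpq ih =>
    rw [← Finset.insert_Icc_right_eq_Icc_add_one (by omega), Finset.sum_insert (by simp),
      Finset.sum_congr rfl (g := fun b => x N * (x N ^ (q - b) * completeInt x N (b + c))),
      ← Finset.mul_sum, ih, completeInt_succ x N ((q + 1 : ℕ) + c)]
    · have h1 : ((q + 1 : ℕ) + c - 1 : ℤ) = q + c := by push_cast; ring
      rw [h1, Nat.sub_self, pow_zero, show q + 1 - p + 1 = (q - p + 1) + 1 by omega,
        pow_succ (x N) (q - p + 1)]
      ring
    · intro b hb
      rw [show q + 1 - b = (q - b) + 1 by have := (Finset.mem_Icc.mp hb).2; omega, pow_succ]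
      ring

/-- The Jacobi–Trudi identity in finitely many variables. -/
theorem det_completeInt (x : ℕ → A) (N n : ℕ) (l : YoungDiagram) (hl : l.rowLen n = 0) :
    Matrix.det (Matrix.of fun i j : Fin n =>
      completeInt x N ((l.rowLen i : ℤ) - (i : ℤ) + (j : ℤ))) = schurEval x N l := by
  induction N generalizing l with
  | zero =>
    -- Without variables h_k is 1 for k = 0 and 0 otherwise: the matrix is the identity for the
    -- empty diagram, and its first row vanishes for any other.
    by_cases h : l = ⊥
    · subst h
      rw [schurEval_bot]
      convert Matrix.det_one (R := A) (n := Fin n)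
      ext i j
      rw [Matrix.of_apply, Matrix.one_apply, rowLen_bot]
      rcases lt_trichotomy i j with hij | rfl | hij
      · rw [if_neg hij.ne, show ((0 : ℕ) - (i : ℤ) + (j : ℤ)) = ((j - i : ℕ) : ℤ) by omega,
          completeInt_natCast, Finset.range_zero, completeEval_empty, if_neg (by omega)]
      · rw [if_pos rfl, show ((0 : ℕ) - (i : ℤ) + (i : ℤ)) = ((0 : ℕ) : ℤ) by omega,
          completeInt_natCast, completeEval_zero]
      · rw [if_neg hij.ne', completeInt_of_neg _ _ (by omega)]
    · rw [schurEval_zero x h]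
      have h0 : 0 < l.rowLen 0 := by
        by_contra! h0
        exact h (ext_rowLen fun i => by
          rw [rowLen_bot, l.rowLen_eq_zero_of_le (Nat.le_zero.mp h0) (Nat.zero_le i)])
      have hn : 0 < n := Nat.pos_of_ne_zero (by rintro rfl; omega)
      refine Matrix.det_eq_zero_of_row_eq_zero ⟨0, hn⟩ fun j => ?_
      rw [Matrix.of_apply, show ((l.rowLen 0 : ℕ) - ((0 : ℕ) : ℤ) + (j : ℤ)) =
        ((l.rowLen 0 + j : ℕ) : ℤ) by push_cast; ring, completeInt_natCast, Finset.range_zero,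
        completeEval_empty, if_neg (by omega)]
  | succ N ih =>
    -- From each row a multiple of the next one is subtracted, which turns entries in `N + 1`
    -- variables into sums of entries in `N` variables.
    have step : Matrix.det (Matrix.of fun i j : Fin n =>
          completeInt x (N + 1) ((l.rowLen i : ℤ) - (i : ℤ) + (j : ℤ))) =
        Matrix.det (Matrix.of fun i j : Fin n =>
          ∑ b ∈ Finset.Icc (l.rowLen (i + 1)) (l.rowLen i),
            x N ^ (l.rowLen i - b) * completeInt x N ((b : ℤ) - (i : ℤ) + (j : ℤ))) := by
      have hrow : ∀ i j : Fin n, ∑ b ∈ Finset.Icc (l.rowLen (i + 1)) (l.rowLen i),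
            x N ^ (l.rowLen i - b) * completeInt x N ((b : ℤ) - (i : ℤ) + (j : ℤ)) =
          completeInt x (N + 1) ((l.rowLen i : ℤ) - (i : ℤ) + (j : ℤ)) -
            x N ^ (l.rowLen i - l.rowLen (i + 1) + 1) * completeInt x (N + 1)
              ((l.rowLen (i + 1) : ℤ) - ((i : ℕ) + 1 : ℕ) + (j : ℤ)) := by
        intro i j
        have := sum_Icc_completeInt x N ((j : ℤ) - (i : ℤ)) (l.rowLen_anti i (i + 1) (by omega))
        have e : ∀ b : ℕ, (b : ℤ) - (i : ℤ) + (j : ℤ) = b + ((j : ℤ) - (i : ℤ)) := fun b => by ring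
        have e' : (l.rowLen (i + 1) : ℤ) - ((i : ℕ) + 1 : ℕ) + (j : ℤ) =
            l.rowLen (i + 1) + ((j : ℤ) - (i : ℤ)) - 1 := by
          push_cast
          ring
        simp only [e, e']
        exact this
      simp only [hrow]
      cases n with
      | zero => rw [Matrix.det_fin_zero, Matrix.det_fin_zero]
      | succ n =>
        -- The determinant lemma subtracts the preceding row, so the order of rows and columns is
        -- reversed.
        rw [← Matrix.det_submatrix_equiv_self Fin.revPerm,
          ← Matrix.det_submatrix_equiv_self Fin.revPerm (Matrix.of _)]
        refine Matrix.det_eq_of_forall_row_eq_smul_add_pred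
          (fun i => x N ^ (l.rowLen (i.succ.rev) - l.rowLen (i.succ.rev + 1) + 1))
          (fun j => ?_) (fun i j => ?_)
        · simp only [Matrix.submatrix_apply, Matrix.of_apply, Fin.revPerm_apply, Fin.val_rev,
            Fin.val_zero]
          -- The last row has no successor; its correction term has degree j - (n + 1) < 0 and
          -- vanishes.
          rw [completeInt_of_neg x (N + 1) (k := ((l.rowLen _ : ℕ) : ℤ) - ((_ + 1 : ℕ) : ℤ) + _),
            mul_zero, sub_zero]
          simp only [Nat.add_sub_cancel, zero_add] at hl ⊢
          rw [hl]
          omega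
        · simp only [Matrix.submatrix_apply, Matrix.of_apply, Fin.revPerm_apply]
          have : ((i.castSucc.rev : Fin (n + 1)) : ℕ) = (i.succ.rev : ℕ) + 1 := by
            simp only [Fin.val_rev, Fin.val_castSucc, Fin.val_succ]
            omega
          rw [this]
          ring
    rw [step, schurEval_succ]
    -- Expanding every row means choosing b_i with l_{i+1} ≤ b_i ≤ l_i for each i. These choices are
    -- exactly the diagrams left after removing a horizontal strip, as in the branching rule.
    have expand := (Matrix.detRowAlternating (R := A) (n := Fin n)).toMultilinearMap.map_sum_finset
      (fun (i : Fin n) (b : ℕ) => x N ^ (l.rowLen i - b) • fun j : Fin n =>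
        completeInt x N ((b : ℤ) - (i : ℤ) + (j : ℤ)))
      (fun i : Fin n => Finset.Icc (l.rowLen (i + 1)) (l.rowLen i))
    have lhs : (Matrix.of fun i j : Fin n => ∑ b ∈ Finset.Icc (l.rowLen (i + 1)) (l.rowLen i),
        x N ^ (l.rowLen i - b) * completeInt x N ((b : ℤ) - (i : ℤ) + (j : ℤ))) =
        fun i : Fin n => ∑ b ∈ Finset.Icc (l.rowLen (i + 1)) (l.rowLen i),
          x N ^ (l.rowLen i - b) • fun j : Fin n =>
            completeInt x N ((b : ℤ) - (i : ℤ) + (j : ℤ)) := by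
      ext i j
      simp [Finset.sum_apply]
    rw [lhs]
    refine expand.trans ?_
    simp only [MultilinearMap.map_smul_univ]
    have hbounds : ∀ b ∈ Fintype.piFinset fun i : Fin n =>
        Finset.Icc (l.rowLen (i + 1)) (l.rowLen i), ∀ i (h : i < n),
        l.rowLen (i + 1) ≤ b ⟨i, h⟩ ∧ b ⟨i, h⟩ ≤ l.rowLen i := fun b hb i h =>
      Finset.mem_Icc.mp (Fintype.mem_piFinset.mp hb ⟨i, h⟩)
    have hrows : ∀ b ∈ Fintype.piFinset fun i : Fin n =>
        Finset.Icc (l.rowLen (i + 1)) (l.rowLen i), ∀ i,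
        (ofRows fun i => if h : i < n then b ⟨i, h⟩ else 0).rowLen i =
          if h : i < n then b ⟨i, h⟩ else 0 := by
      intro b hb i
      refine rowLen_ofRows (antitone_nat_of_succ_le fun i => ?_) (n := n)
        (dif_neg (lt_irrefl n)) i
      by_cases h1 : i + 1 < n
      · rw [dif_pos h1, dif_pos (Nat.lt_of_succ_lt h1)]
        exact (hbounds b hb _ h1).2.trans (hbounds b hb _ (Nat.lt_of_succ_lt h1)).1
      · rw [dif_neg h1]
        exact Nat.zero_le _
    refine Finset.sum_bij'
      (fun b _ => ofRows fun i => if h : i < n then b ⟨i, h⟩ else 0)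
      (fun μ _ => fun i => μ.rowLen i) ?_ ?_ ?_ ?_ ?_
    · intro b hb
      refine mem_removeStrips.mpr fun i => ?_
      rw [hrows b hb]
      by_cases h : i < n
      · rw [dif_pos h]
        exact hbounds b hb i h
      · rw [dif_neg h, l.rowLen_eq_zero_of_le hl (by omega : n ≤ i + 1)]
        exact ⟨le_rfl, Nat.zero_le _⟩
    · intro μ hμ
      rw [mem_removeStrips] at hμ
      exact Fintype.mem_piFinset.mpr fun i => Finset.mem_Icc.mpr (hμ i)
    · intro b hb
      funext i
      rw [hrows b hb, dif_pos i.isLt]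
    · intro μ hμ
      rw [mem_removeStrips] at hμ
      have h0 : μ.rowLen n = 0 := Nat.le_zero.mp (hl ▸ (hμ n).2)
      have hf : (fun i => if h : i < n then μ.rowLen ((⟨i, h⟩ : Fin n) : ℕ) else 0) =
          μ.rowLen := by
        funext i
        by_cases h : i < n
        · rw [dif_pos h]
        · rw [dif_neg h, μ.rowLen_eq_zero_of_le h0 (by omega)]
      rw [hf]
      exact ext_rowLen fun i => rowLen_ofRows (fun i j h => μ.rowLen_anti i j h) h0 i
    · intro b hb
      have hr := hrows b hb
      set μ := ofRows fun i => if h : i < n then b ⟨i, h⟩ else 0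
      have hb' : ∀ i : Fin n, b i = μ.rowLen i := fun i => by rw [hr, dif_pos i.isLt]
      have h0 : μ.rowLen n = 0 := by rw [hr, dif_neg (lt_irrefl n)]
      rw [← ih μ h0, smul_eq_mul, Finset.prod_pow_eq_pow_sum, card_eq_sum_rowLen l hl,
        card_eq_sum_rowLen μ h0, ← Fin.sum_univ_eq_sum_range, ← Fin.sum_univ_eq_sum_range,
        ← Finset.sum_tsub_distrib]
      · simp only [hb']
        rfl
      · intro i _
        rw [← hb']
        exact (hbounds b hb i i.isLt).2

end FiniteIdentities

/-! ### Homogeneous power series, the Euler derivation and its differential equation. -/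

namespace MvPowerSeries

variable {σ K : Type*} [Field K]

theorem isHomogeneous_iff {f : MvPowerSeries σ K} {n : ℕ} :
    f.IsHomogeneous n ↔ ∀ d, coeff d f ≠ 0 → d.degree = n :=
  ⟨fun hf d hd => not_imp_comm.mp hf.coeff_eq_zero hd, fun h d hd => by
    rw [← h d hd, Finsupp.degree_eq_weight_one]
    rfl⟩

theorem IsHomogeneous.degree_eq {f : MvPowerSeries σ K} {n : ℕ} (hf : f.IsHomogeneous n)
    {d : σ →₀ ℕ} (hd : coeff d f ≠ 0) : d.degree = n :=
  isHomogeneous_iff.mp hf d hd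

theorem IsHomogeneous.sum {ι : Type*} {s : Finset ι} {f : ι → MvPowerSeries σ K} {n : ℕ}
    (hf : ∀ i ∈ s, (f i).IsHomogeneous n) : (∑ i ∈ s, f i).IsHomogeneous n := by
  refine isHomogeneous_iff.mpr fun d hd => ?_
  rw [map_sum] at hd
  obtain ⟨i, hi, hne⟩ := Finset.exists_ne_zero_of_sum_ne_zero hd
  exact IsHomogeneous.degree_eq (hf i hi) hne

theorem IsHomogeneous.smul {f : MvPowerSeries σ K} {n : ℕ} (hf : f.IsHomogeneous n) (c : K) :
    (c • f).IsHomogeneous n := by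
  refine isHomogeneous_iff.mpr fun d hd => ?_
  rw [coeff_smul] at hd
  exact hf.degree_eq (right_ne_zero_of_mul hd)

theorem IsHomogeneous.rename {τ : Type*} {f : MvPowerSeries σ K} {n : ℕ} (hf : f.IsHomogeneous n)
    (e : σ ↪ τ) :
    (MvPowerSeries.rename e f).IsHomogeneous n := by
  refine isHomogeneous_iff.mpr fun d hd => ?_
  by_cases h : d ∈ Set.range (Finsupp.mapDomain e)
  · obtain ⟨d, rfl⟩ := h
    rw [← Finsupp.embDomain_eq_mapDomain, coeff_embDomain_rename] at hd
    rw [Finsupp.degree_mapDomain, hf.degree_eq hd]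
  · exact absurd (coeff_rename_eq_zero e f h) hd

variable (σ K) in
/-- The Euler derivation, which multiplies a monomial by its degree. -/
noncomputable def euler : Derivation K (MvPowerSeries σ K) (MvPowerSeries σ K) :=
  Derivation.mk'
    { toFun := fun f d => (d.degree : K) * coeff d f
      map_add' := fun f g => by
        ext d
        exact mul_add _ _ _
      map_smul' := fun c f => by
        ext d
        exact mul_left_comm _ _ _ }
    fun f g => by
      classical
      ext d
      rw [map_add, smul_eq_mul, smul_eq_mul, mul_comm g, coeff_mul, coeff_mul,
        ← Finset.sum_add_distrib]
      change (d.degree : K) * coeff d (f * g) = _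
      rw [coeff_mul, Finset.mul_sum]
      refine Finset.sum_congr rfl fun p hp => ?_
      change _ = coeff p.1 f * ((p.2.degree : K) * coeff p.2 g) +
        ((p.1.degree : K) * coeff p.1 f) * coeff p.2 g
      rw [← Finset.HasAntidiagonal.mem_antidiagonal.mp hp, map_add]
      push_cast
      ring

theorem coeff_euler (f : MvPowerSeries σ K) (d : σ →₀ ℕ) :
    coeff d (euler σ K f) = d.degree * coeff d f := rfl

theorem IsHomogeneous.euler_eq {f : MvPowerSeries σ K} {n : ℕ} (hf : f.IsHomogeneous n) :
    euler σ K f = (n : K) • f := by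
  ext d
  rw [coeff_euler, coeff_smul]
  by_cases h : coeff d f = 0
  · rw [h, mul_zero, mul_zero]
  · rw [hf.degree_eq h]

variable [TopologicalSpace K]

theorem continuous_rename {τ : Type*} (e : σ ↪ τ) :
    Continuous (MvPowerSeries.rename (R := K) e) := by
  refine continuous_pi fun d => ?_
  change Continuous fun f => coeff d (MvPowerSeries.rename (R := K) e f)
  by_cases h : d ∈ Set.range (Finsupp.mapDomain e)
  · obtain ⟨d, rfl⟩ := h
    simp only [← Finsupp.embDomain_eq_mapDomain, coeff_embDomain_rename]
    exact WithPiTopology.continuous_coeff K d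
  · simp only [coeff_rename_eq_zero e _ h]
    exact continuous_const

theorem summable_of_finite_coeff_ne_zero {ι : Type*} {f : ι → MvPowerSeries σ K}
    (h : ∀ d, {i | coeff d (f i) ≠ 0}.Finite) : Summable f :=
  WithPiTopology.summable_iff_summable_coeff.mpr fun d => summable_of_hasFiniteSupport (h d)

theorem summable_of_isHomogeneous {f : ℕ → MvPowerSeries σ K} {w : ℕ → ℕ}
    (hw : Function.Injective w)
    (h : ∀ n, (f n).IsHomogeneous (w n)) : Summable f :=
  summable_of_finite_coeff_ne_zero fun d => (Set.finite_singleton d.degree).preimage hw.injOn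
    |>.subset fun n hn => (IsHomogeneous.degree_eq (h n) hn).symm

/-- Each coefficient of the substitution is a finite sum. Presenting the exponential as a convergent
series lets the continuous `euler` act termwise. -/
theorem hasSum_exp_subst [CharZero K] {E : MvPowerSeries σ K} (hE : PowerSeries.HasSubst E) :
    HasSum (fun n : ℕ => ((n.factorial : K)⁻¹) • E ^ n) ((PowerSeries.exp K).subst E) := by
  refine WithPiTopology.hasSum_iff_hasSum_coeff.mpr fun d => ?_
  have hfin := PowerSeries.coeff_subst_finite hE (PowerSeries.exp K) d
  rw [PowerSeries.coeff_subst hE, ← tsum_eq_finsum (L := SummationFilter.unconditional ℕ) hfin]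
  have heq : (fun n : ℕ => coeff d ((n.factorial : K)⁻¹ • E ^ n)) =
      fun n => PowerSeries.coeff n (PowerSeries.exp K) • coeff d (E ^ n) := by
    funext n
    rw [PowerSeries.coeff_exp, coeff_smul]
    simp
  rw [heq]
  exact (summable_of_hasFiniteSupport hfin).hasSum

variable [DiscreteTopology K]

instance : T3Space (MvPowerSeries σ K) := inferInstanceAs (T3Space ((σ →₀ ℕ) → K))

theorem continuous_euler : Continuous (euler σ K) := by
  refine continuous_pi fun d => ?_
  exact continuous_const.mul (WithPiTopology.continuous_coeff K d)

theorem coeff_eq_of_hasSum_isHomogeneous {f : ℕ → MvPowerSeries σ K} {w : ℕ → ℕ}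
    {F : MvPowerSeries σ K}
    (hf : HasSum f F) (hw : Function.Injective w) (h : ∀ n, (f n).IsHomogeneous (w n)) {n : ℕ}
    {d : σ →₀ ℕ} (hd : d.degree = w n) : coeff d F = coeff d (f n) := by
  refine (WithPiTopology.hasSum_iff_hasSum_coeff.mp hf d).unique (hasSum_single n fun m hm => ?_)
  by_contra hne
  exact hm (hw ((IsHomogeneous.degree_eq (h m) hne).symm.trans hd))

variable [CharZero K]

/-- The solutions `P` of the differential equations `euler P = P * G` with constant coefficient `1`
depend continuously on `G`. -/
theorem tendsto_of_euler_eq_mul {α : Type*} {l : Filter α} {P G : α → MvPowerSeries σ K}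
    {P' G' : MvPowerSeries σ K} (hP : ∀ a, euler σ K (P a) = P a * G a)
    (hP' : euler σ K P' = P' * G') (h1 : ∀ a, constantCoeff (P a) = 1)
    (h1' : constantCoeff P' = 1) (hG : Tendsto G l (𝓝 G')) : Tendsto P l (𝓝 P') := by
  classical
  -- D P has no constant term, so neither has G.
  have hzero : ∀ {P G : MvPowerSeries σ K}, euler σ K P = P * G → constantCoeff P = 1 →
      constantCoeff G = 0 := by
    intro P G hP h1
    have := congrArg constantCoeff hP
    rw [map_mul, h1, one_mul] at this
    rw [← this, ← coeff_zero_eq_constantCoeff_apply, coeff_euler, map_zero, Nat.cast_zero, zero_mul]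
  have hcoeff : ∀ {P G : MvPowerSeries σ K}, euler σ K P = P * G → ∀ d : σ →₀ ℕ, d ≠ 0 →
      coeff d P = (d.degree : K)⁻¹ *
        ∑ p ∈ Finset.HasAntidiagonal.antidiagonal d, coeff p.1 P * coeff p.2 G := by
    intro P G hP d hd
    rw [← coeff_mul, ← hP, coeff_euler, inv_mul_cancel_left₀]
    exact Nat.cast_ne_zero.mpr ((Finsupp.degree_eq_zero_iff d).not.mpr hd)
  rw [WithPiTopology.tendsto_iff_coeff_tendsto] at hG ⊢
  intro d
  induction hn : d.degree using Nat.strong_induction_on generalizing d with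
  | _ n ih =>
    by_cases hd : d = 0
    · subst hd
      simp only [coeff_zero_eq_constantCoeff_apply, h1, h1']
      exact tendsto_const_nhds
    · rw [hcoeff hP' d hd]
      simp only [hcoeff (hP _) d hd]
      refine tendsto_const_nhds.mul (tendsto_finsetSum _ fun p hp => ?_)
      have hadd := congrArg Finsupp.degree (Finset.HasAntidiagonal.mem_antidiagonal.mp hp)
      rw [map_add] at hadd
      -- The term with `p.2 = 0` contains the coefficient of P being computed, but drops out because
      -- G has no constant term; all others involve lower degrees of P.
      by_cases h2 : p.2 = 0
      · simp only [h2, coeff_zero_eq_constantCoeff_apply, hzero (hP _) (h1 _), hzero hP' h1',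
          mul_zero]
        exact tendsto_const_nhds
      · have := (Finsupp.degree_eq_zero_iff p.2).not.mpr h2
        exact (ih p.1.degree (by omega) p.1 rfl).mul (hG p.2)

theorem eq_of_euler_eq_mul {P P' G : MvPowerSeries σ K} (hP : euler σ K P = P * G)
    (hP' : euler σ K P' = P' * G) (h1 : constantCoeff P = 1) (h1' : constantCoeff P' = 1) :
    P = P' :=
  tendsto_nhds_unique (tendsto_const_nhds (f := (atTop : Filter ℕ)))
    (tendsto_of_euler_eq_mul (fun _ => hP) hP' (fun _ => h1) h1'
      (tendsto_const_nhds (f := (atTop : Filter ℕ))))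

theorem constantCoeff_exp_subst {E : MvPowerSeries σ K} (hE : constantCoeff E = 0) :
    constantCoeff ((PowerSeries.exp K).subst E) = 1 := by
  have h := WithPiTopology.hasSum_iff_hasSum_coeff.mp
    (hasSum_exp_subst (PowerSeries.HasSubst.of_constantCoeff_zero hE)) 0
  refine h.unique ?_
  convert hasSum_single 0 fun n hn => ?_
  · simp
  · rw [coeff_smul, coeff_zero_eq_constantCoeff_apply, map_pow, hE, zero_pow hn, mul_zero]

/-- Termwise, D(E^{n+1}/(n+1)!) = (E^n/n!) D E; the term of index 0 is killed, whence the shift. -/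
theorem euler_exp_subst {E : MvPowerSeries σ K} (hE : PowerSeries.HasSubst E) :
    euler σ K ((PowerSeries.exp K).subst E) = (PowerSeries.exp K).subst E * euler σ K E := by
  have h := hasSum_exp_subst hE
  have h1 := (h.map (euler σ K) continuous_euler)
  rw [← hasSum_nat_add_iff' 1] at h1
  have h2 := h.mul_right (euler σ K E)
  have h3 : euler σ K ((PowerSeries.exp K).subst E) - ∑ i ∈ Finset.range 1,
      (euler σ K ∘ fun n : ℕ => ((n.factorial : K)⁻¹) • E ^ n) i =
      euler σ K ((PowerSeries.exp K).subst E) := by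
    rw [Finset.sum_range_one, Function.comp_apply, pow_zero, Derivation.map_smul,
      Derivation.map_one_eq_zero, smul_zero, sub_zero]
  rw [h3] at h1
  refine h1.unique ?_
  have h6 : ∀ n : ℕ, (euler σ K ∘ fun n : ℕ => ((n.factorial : K)⁻¹) • E ^ n) (n + 1) =
      ((n.factorial : K)⁻¹) • E ^ n * euler σ K E := ?_
  · exact (funext h6 : _ = _) ▸ h2
  intro n
  rw [Function.comp_apply, Derivation.map_smul, Derivation.leibniz_pow, Nat.add_sub_cancel,
    smul_mul_assoc, smul_eq_mul, ← Nat.cast_smul_eq_nsmul K, smul_smul, Nat.factorial_succ]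
  congr 1
  have h4 : ((n + 1 : ℕ) : K) ≠ 0 := Nat.cast_ne_zero.mpr (Nat.succ_ne_zero n)
  have h5 : (n.factorial : K) ≠ 0 := Nat.cast_ne_zero.mpr n.factorial_ne_zero
  rw [Nat.cast_mul]
  field_simp

end MvPowerSeries

/-! ### Elementary Schur polynomials as limits of complete symmetric polynomials. -/

section ElementarySchur

variable {K : Type*} [Field K]

theorem hasSubst_mk_ite : PowerSeries.HasSubst
    (PowerSeries.mk fun i : ℕ => if i = 0 then 0 else (MvPolynomial.X i : MvPolynomial ℕ K)) := by
  refine PowerSeries.HasSubst.of_constantCoeff_zero' ?_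
  rw [← PowerSeries.coeff_zero_eq_constantCoeff_apply, PowerSeries.coeff_mk, if_pos rfl]

variable [CharZero K]

theorem elemSchurPoly_natCast (n : ℕ) :
    elemSchurPoly K n = PowerSeries.coeff n
      ((PowerSeries.exp (MvPolynomial ℕ K)).subst
        (PowerSeries.mk fun i : ℕ => if i = 0 then 0 else (MvPolynomial.X i : MvPolynomial ℕ K))) := by
  rw [elemSchurPoly, if_pos (Int.natCast_nonneg n), Int.toNat_natCast]

theorem elemSchurPoly_zero : elemSchurPoly K 0 = 1 := by
  have := elemSchurPoly_natCast (K := K) 0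
  rw [Nat.cast_zero] at this
  rw [this, PowerSeries.coeff_subst' hasSubst_mk_ite, finsum_eq_single _ 0]
  · simp
  · intro n hn
    rw [PowerSeries.coeff_zero_eq_constantCoeff_apply, map_pow,
      ← PowerSeries.coeff_zero_eq_constantCoeff_apply, PowerSeries.coeff_mk, if_pos rfl,
      zero_pow hn, smul_zero]

/-- Differentiating exp(∑ t_i z^i) in z gives Newton's recursion with k t_k in place of the power
sum p_k. -/
theorem succ_mul_elemSchurPoly (n : ℕ) :
    ((n + 1 : ℕ) : MvPolynomial ℕ K) * elemSchurPoly K ((n + 1 : ℕ) : ℤ) =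
      ∑ p ∈ Finset.HasAntidiagonal.antidiagonal n, elemSchurPoly K p.1 *
        (((p.2 + 1 : ℕ) : MvPolynomial ℕ K) * MvPolynomial.X (p.2 + 1)) := by
  have h := congrArg (PowerSeries.coeff n)
    (PowerSeries.derivative_subst (f := PowerSeries.exp (MvPolynomial ℕ K)) hasSubst_mk_ite)
  rw [PowerSeries.derivative_exp, PowerSeries.coeff_derivative, PowerSeries.coeff_mul] at h
  simp only [← elemSchurPoly_natCast, PowerSeries.coeff_derivative, PowerSeries.coeff_mk,
    Nat.succ_ne_zero, if_false] at h
  rw [mul_comm]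
  push_cast at h ⊢
  rw [h]
  refine Finset.sum_congr rfl fun p _ => ?_
  ring

/-- Complete homogeneous symmetric polynomials converge to the elementary Schur polynomials if the
power sums converge. -/
theorem tendsto_completeEval {B α ι : Type*} [CommRing B] [Algebra K B] [TopologicalSpace B]
    [IsTopologicalRing B] {l : Filter α} (S : α → Finset ι) (w : ι → B) (τ : ℕ → B)
    (hp : ∀ k : ℕ, Tendsto (fun a => ∑ i ∈ S a, w i ^ (k + 1)) l
      (𝓝 (((k + 1 : ℕ) : B) * τ (k + 1))))
    (n : ℕ) : Tendsto (fun a => completeEval (S a) w n) l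
      (𝓝 (MvPolynomial.aeval τ (elemSchurPoly K n))) := by
  induction n using Nat.strong_induction_on with
  | _ n ih =>
    cases n with
    | zero =>
      simp only [completeEval_zero, Nat.cast_zero, elemSchurPoly_zero, map_one]
      exact tendsto_const_nhds
    | succ n =>
      have hc : ((n + 1 : ℕ) : K) ≠ 0 := Nat.cast_ne_zero.mpr (Nat.succ_ne_zero n)
      -- Division by n + 1, possible in a `K`-algebra, makes Newton's recursion determine the next
      -- term from the earlier ones.
      have hinv : ∀ b : B, b = algebraMap K B ((n + 1 : ℕ) : K)⁻¹ * (((n + 1 : ℕ) : B) * b) := by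
        intro b
        rw [← map_natCast (algebraMap K B), ← mul_assoc, ← map_mul, inv_mul_cancel₀ hc, map_one,
          one_mul]
      have h := congrArg (MvPolynomial.aeval τ) (succ_mul_elemSchurPoly (K := K) n)
      simp only [map_mul, map_natCast, map_sum, MvPolynomial.aeval_X] at h
      rw [hinv (MvPolynomial.aeval τ _), h]
      have h2 : (fun a => completeEval (S a) w (n + 1)) = fun a =>
          algebraMap K B ((n + 1 : ℕ) : K)⁻¹ * ∑ p ∈ Finset.HasAntidiagonal.antidiagonal n,
            completeEval (S a) w p.1 * ∑ i ∈ S a, w i ^ (p.2 + 1) := by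
        funext a
        rw [← succ_mul_completeEval, ← hinv]
      rw [h2]
      refine tendsto_const_nhds.mul (tendsto_finsetSum _ fun p hp' => ?_)
      have := Finset.HasAntidiagonal.mem_antidiagonal.mp hp'
      exact (ih p.1 (by omega)).mul (hp p.2)

end ElementarySchur

/-! ### Passage to infinitely many variables. -/

section InfinitelyManyVariables

theorem schurEval_map {A B : Type*} [CommRing A] [CommRing B] (φ : A →+* B) (x : ℕ → A) (N : ℕ)
    (μ : YoungDiagram) : φ (schurEval x N μ) = schurEval (fun i => φ (x i)) N μ := by
  simp only [schurEval, map_sum, map_prod]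

theorem tendsto_range_product_range :
    Tendsto (fun N => Finset.range N ×ˢ Finset.range N) atTop (atTop : Filter (Finset (ℕ × ℕ))) := by
  refine tendsto_atTop_finset_of_monotone (fun M N h => ?_) fun p => ⟨p.1 + p.2 + 1, ?_⟩
  · exact Finset.product_subset_product (Finset.range_subset_range.mpr h)
      (Finset.range_subset_range.mpr h)
  · rw [Finset.mem_product, Finset.mem_range, Finset.mem_range]
    omega

variable {K : Type*} [Field K]

theorem prod_X_eq_monomial {μ : YoungDiagram} (T : SemistandardYoungTableau μ) :
    ∏ c ∈ μ.cells, (X (T c.1 c.2) : MvPowerSeries ℕ K) = monomial T.content 1 := by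
  classical
  rw [SemistandardYoungTableau.content]
  induction μ.cells using Finset.induction_on with
  | empty => rw [Finset.prod_empty, Finset.sum_empty, monomial_zero_one]
  | insert c s hc ih =>
    rw [Finset.prod_insert hc, Finset.sum_insert hc, ih, X_def, monomial_mul_monomial, one_mul]

theorem isHomogeneous_schurFunction (μ : YoungDiagram) :
    (schurFunction K μ).IsHomogeneous μ.card := by
  refine isHomogeneous_iff.mpr fun d hd => ?_
  have hne : Nat.card {T : SemistandardYoungTableau μ // T.content = d} ≠ 0 :=
    fun h => hd (by change (Nat.card _ : K) = 0; rw [h, Nat.cast_zero])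
  obtain ⟨⟨T, rfl⟩⟩ := (Nat.card_ne_zero.mp hne).1
  rw [SemistandardYoungTableau.content, map_sum]
  simp [Finsupp.degree_single]

theorem isHomogeneous_powerSum (k : ℕ) : (powerSum K k).IsHomogeneous k := by
  refine isHomogeneous_iff.mpr fun d hd => ?_
  have h : ∃ i : ℕ, d = Finsupp.single i k := by
    by_contra h
    exact hd (if_neg h)
  obtain ⟨i, rfl⟩ := h
  exact Finsupp.degree_single i k

/-- A tableau of content `d` has its entries in the support of `d`, so the bound `N` excludes none
of those counted. -/
theorem coeff_schurEval_X (N : ℕ) (μ : YoungDiagram) {d : ℕ →₀ ℕ} (hd : ∀ i ∈ d.support, i < N) :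
    coeff d (schurEval (fun i => (X i : MvPowerSeries ℕ K)) N μ) = coeff d (schurFunction K μ) := by
  classical
  change _ = (Nat.card {T : SemistandardYoungTableau μ // T.content = d} : K)
  simp only [schurEval, prod_X_eq_monomial, map_sum, coeff_monomial]
  rw [Finset.sum_boole, Nat.subtype_card]
  intro T
  rw [Finset.mem_filter, mem_bounded, eq_comm, and_iff_right_iff_imp]
  rintro rfl i j hc
  refine hd _ (Finsupp.mem_support_iff.mpr fun h0 => ?_)
  rw [SemistandardYoungTableau.content, Finsupp.finsetSum_apply] at h0
  have := Finset.sum_eq_zero_iff.mp h0 (i, j) ((mem_cells _).mpr hc)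
  simp at this

variable (K) in
/-- The product `x_i y_j` of a variable of each family. -/
noncomputable def pairVar (p : ℕ × ℕ) : MvPowerSeries (ℕ ⊕ ℕ) K :=
  inX (X p.1) * inY (X p.2)

theorem pairVar_pow (p : ℕ × ℕ) (k : ℕ) : pairVar K p ^ k =
    monomial (Finsupp.single (Sum.inl p.1) k + Finsupp.single (Sum.inr p.2) k) 1 := by
  rw [pairVar, inX, inY, rename_X, rename_X, mul_pow, X_pow_eq, X_pow_eq, monomial_mul_monomial,
    one_mul]
  rfl

theorem isHomogeneous_pairVar_pow (p : ℕ × ℕ) (k : ℕ) :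
    (pairVar K p ^ k).IsHomogeneous (2 * k) := by
  classical
  refine isHomogeneous_iff.mpr fun d hd => ?_
  rw [pairVar_pow, coeff_monomial] at hd
  rw [(ite_ne_right_iff.mp hd).1, map_add, Finsupp.degree_single, Finsupp.degree_single, two_mul]

theorem mem_of_coeff_pairVar_pow_ne_zero {p : ℕ × ℕ} {k : ℕ} {d : ℕ ⊕ ℕ →₀ ℕ}
    (h : coeff d (pairVar K p ^ (k + 1)) ≠ 0) :
    p ∈ (Sum.inl ⁻¹' (d.support : Set (ℕ ⊕ ℕ))) ×ˢ (Sum.inr ⁻¹' (d.support : Set (ℕ ⊕ ℕ))) := by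
  classical
  rw [pairVar_pow, coeff_monomial] at h
  rw [(ite_ne_right_iff.mp h).1]
  simp

theorem finite_preimage_support (d : ℕ ⊕ ℕ →₀ ℕ) :
    ((Sum.inl ⁻¹' (d.support : Set (ℕ ⊕ ℕ))) ×ˢ
      (Sum.inr ⁻¹' (d.support : Set (ℕ ⊕ ℕ))) : Set (ℕ × ℕ)).Finite :=
  (d.support.finite_toSet.preimage Sum.inl_injective.injOn).prod
    (d.support.finite_toSet.preimage Sum.inr_injective.injOn)

variable (K) in
/-- The product `(∑ᵢ xᵢ ^ k) (∑ⱼ yⱼ ^ k)` of power sums. -/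
noncomputable def pairPowerSum (k : ℕ) : MvPowerSeries (ℕ ⊕ ℕ) K :=
  inX (powerSum K k) * inY (powerSum K k)

theorem isHomogeneous_pairPowerSum (k : ℕ) : (pairPowerSum K k).IsHomogeneous (2 * k) := by
  rw [two_mul]
  exact IsHomogeneous.mul (IsHomogeneous.rename (isHomogeneous_powerSum k) _)
    (IsHomogeneous.rename (isHomogeneous_powerSum k) _)

variable (K) in
/-- The part of the sum of products of Schur functions with shapes of size `n`. -/
noncomputable def cauchyPart (n : ℕ) : MvPowerSeries (ℕ ⊕ ℕ) K :=
  ∑ l ∈ ofCard n, inX (schurFunction K l) * inY (schurFunction K l)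

theorem isHomogeneous_inX_mul_inY_schurFunction (l : YoungDiagram) :
    (inX (schurFunction K l) * inY (schurFunction K l)).IsHomogeneous (2 * l.card) := by
  rw [two_mul]
  exact IsHomogeneous.mul (IsHomogeneous.rename (isHomogeneous_schurFunction l) _)
    (IsHomogeneous.rename (isHomogeneous_schurFunction l) _)

theorem isHomogeneous_cauchyPart (n : ℕ) : (cauchyPart K n).IsHomogeneous (2 * n) := by
  refine IsHomogeneous.sum fun l hl => ?_
  rw [← mem_ofCard.mp hl]
  exact isHomogeneous_inX_mul_inY_schurFunction l

theorem tendsto_schurEval_X [TopologicalSpace K] (μ : YoungDiagram) :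
    Tendsto (fun N => schurEval (fun i => (X i : MvPowerSeries ℕ K)) N μ) atTop
      (𝓝 (schurFunction K μ)) := by
  refine (WithPiTopology.tendsto_iff_coeff_tendsto _ _ _).mpr fun d => ?_
  refine tendsto_atTop_of_eventually_const (i₀ := d.support.sup id + 1) fun N hN => ?_
  exact coeff_schurEval_X N μ fun i hi =>
    (Nat.lt_succ_of_le (Finset.le_sup (f := id) hi)).trans_le hN

theorem tendsto_schurEval_inX [TopologicalSpace K] (μ : YoungDiagram) :
    Tendsto (fun N => schurEval (fun i => inX (X i : MvPowerSeries ℕ K)) N μ) atTop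
      (𝓝 (inX (schurFunction K μ))) := by
  have := ((continuous_rename (K := K) (Function.Embedding.inl : ℕ ↪ ℕ ⊕ ℕ)).tendsto _).comp
    (tendsto_schurEval_X μ)
  refine this.congr fun N => ?_
  exact schurEval_map (A := MvPowerSeries ℕ K) (B := MvPowerSeries (ℕ ⊕ ℕ) K)
    (MvPowerSeries.rename (Function.Embedding.inl : ℕ ↪ ℕ ⊕ ℕ) : _ →ₐ[K] _) _ N μ

theorem tendsto_schurEval_inY [TopologicalSpace K] (μ : YoungDiagram) :
    Tendsto (fun N => schurEval (fun i => inY (X i : MvPowerSeries ℕ K)) N μ) atTop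
      (𝓝 (inY (schurFunction K μ))) := by
  have := ((continuous_rename (K := K) (Function.Embedding.inr : ℕ ↪ ℕ ⊕ ℕ)).tendsto _).comp
    (tendsto_schurEval_X μ)
  refine this.congr fun N => ?_
  exact schurEval_map (A := MvPowerSeries ℕ K) (B := MvPowerSeries (ℕ ⊕ ℕ) K)
    (MvPowerSeries.rename (Function.Embedding.inr : ℕ ↪ ℕ ⊕ ℕ) : _ →ₐ[K] _) _ N μ

/-- The Cauchy identity in N + N variables turns this into the convergence of finitely many products
of Schur polynomials. -/
theorem tendsto_completeEval_pairVar [TopologicalSpace K] [DiscreteTopology K] (n : ℕ) :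
    Tendsto (fun N => completeEval (Finset.range N ×ˢ Finset.range N) (pairVar K) n) atTop
      (𝓝 (cauchyPart K n)) := by
  have h : Tendsto (fun N => ∑ l ∈ ofCard n,
      schurEval (fun i => inX (X i : MvPowerSeries ℕ K)) N l *
        schurEval (fun i => inY (X i : MvPowerSeries ℕ K)) N l) atTop (𝓝 (cauchyPart K n)) :=
    tendsto_finsetSum _ fun l _ => (tendsto_schurEval_inX l).mul (tendsto_schurEval_inY l)
  simp only [sum_ofCard_schurEval_mul_schurEval] at h
  exact h

theorem hasSum_X_pow [TopologicalSpace K] (k : ℕ) :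
    HasSum (fun i => (X i : MvPowerSeries ℕ K) ^ (k + 1)) (powerSum K (k + 1)) := by
  classical
  refine WithPiTopology.hasSum_iff_hasSum_coeff.mpr fun d => ?_
  simp only [coeff_X_pow]
  change HasSum _ (if ∃ i : ℕ, d = Finsupp.single i (k + 1) then (1 : K) else 0)
  split_ifs with h
  · obtain ⟨i, rfl⟩ := h
    convert hasSum_single i fun j hj => ?_
    · rw [if_pos rfl]
    · exact if_neg fun h => hj (Finsupp.single_left_injective (Nat.succ_ne_zero k) h).symm
  · convert hasSum_zero with i
    exact if_neg fun h' => h ⟨i, h'⟩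

theorem hasSum_pairVar_pow [TopologicalSpace K] [DiscreteTopology K] (k : ℕ) :
    HasSum (fun p => pairVar K p ^ (k + 1))
    (inX (powerSum K (k + 1)) * inY (powerSum K (k + 1))) := by
  have hx := (hasSum_X_pow (K := K) k).map
    (MvPowerSeries.rename (Function.Embedding.inl : ℕ ↪ ℕ ⊕ ℕ)) (continuous_rename _)
  have hy := (hasSum_X_pow (K := K) k).map
    (MvPowerSeries.rename (Function.Embedding.inr : ℕ ↪ ℕ ⊕ ℕ)) (continuous_rename _)
  have heq : (fun p => pairVar K p ^ (k + 1)) = fun p : ℕ × ℕ =>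
      (MvPowerSeries.rename (Function.Embedding.inl : ℕ ↪ ℕ ⊕ ℕ) ∘
        fun i => (X i : MvPowerSeries ℕ K) ^ (k + 1)) p.1 *
      (MvPowerSeries.rename (Function.Embedding.inr : ℕ ↪ ℕ ⊕ ℕ) ∘
        fun i => (X i : MvPowerSeries ℕ K) ^ (k + 1)) p.2 := by
    funext p
    rw [pairVar, mul_pow, Function.comp_apply, Function.comp_apply, map_pow, map_pow]
    rfl
  rw [heq]
  refine hx.mul hy ?_
  rw [← heq]
  exact summable_of_finite_coeff_ne_zero fun d =>
    (finite_preimage_support d).subset fun p hp => mem_of_coeff_pairVar_pow_ne_zero hp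

theorem cauchyPart_zero [TopologicalSpace K] [DiscreteTopology K] : cauchyPart K 0 = 1 := by
  refine tendsto_nhds_unique (tendsto_completeEval_pairVar (K := K) 0) ?_
  simp only [completeEval_zero]
  exact tendsto_const_nhds

/-- Newton's identities for the variables x_i y_j, i, j < N, in the limit; the power sums of these
variables tend to p_k(x) p_k(y). -/
theorem succ_mul_cauchyPart [TopologicalSpace K] [DiscreteTopology K] (n : ℕ) :
    ((n + 1 : ℕ) : MvPowerSeries (ℕ ⊕ ℕ) K) * cauchyPart K (n + 1) =
      ∑ p ∈ Finset.HasAntidiagonal.antidiagonal n, cauchyPart K p.1 * pairPowerSum K (p.2 + 1) := by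
  have h1 := (tendsto_const_nhds (x := ((n + 1 : ℕ) : MvPowerSeries (ℕ ⊕ ℕ) K))).mul
    (tendsto_completeEval_pairVar (K := K) (n + 1))
  simp only [succ_mul_completeEval] at h1
  refine tendsto_nhds_unique h1 (tendsto_finsetSum _ fun p _ => ?_)
  exact (tendsto_completeEval_pairVar p.1).mul
    ((hasSum_pairVar_pow p.2).comp tendsto_range_product_range)

variable [CharZero K]

theorem succ_mul_timeVar (k : ℕ) :
    ((k + 1 : ℕ) : MvPowerSeries ℕ K) * timeVar K (k + 1) = powerSum K (k + 1) := by
  rw [timeVar, mul_smul_comm, ← nsmul_eq_mul, ← Nat.cast_smul_eq_nsmul K, smul_smul,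
    inv_mul_cancel₀ (Nat.cast_ne_zero.mpr (Nat.succ_ne_zero k)), one_smul]

variable [TopologicalSpace K] [DiscreteTopology K]

theorem tendsto_completeInt_X (k : ℤ) :
    Tendsto (fun N => completeInt (fun i => (X i : MvPowerSeries ℕ K)) N k) atTop
      (𝓝 (MvPolynomial.aeval (timeVar K) (elemSchurPoly K k))) := by
  rcases lt_or_ge k 0 with hk | hk
  · rw [elemSchurPoly, if_neg (not_le.mpr hk), map_zero]
    simp only [completeInt_of_neg _ _ hk]
    exact tendsto_const_nhds
  · lift k to ℕ using hk
    simp only [completeInt_natCast]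
    refine tendsto_completeEval (fun N => Finset.range N) _ _ (fun k => ?_) k
    rw [succ_mul_timeVar]
    exact (hasSum_X_pow k).tendsto_sum_nat

/-- The Jacobi–Trudi identity. -/
theorem aeval_timeVar_schurPoly (μ : YoungDiagram) :
    MvPolynomial.aeval (timeVar K) (schurPoly K μ) = schurFunction K μ := by
  have h : Tendsto (fun N => Matrix.det (Matrix.of fun i j : Fin μ.card =>
      completeInt (fun i => (X i : MvPowerSeries ℕ K)) N
        ((μ.rowLen i : ℤ) - (i : ℤ) + (j : ℤ)))) atTop
      (𝓝 (Matrix.det (Matrix.of fun i j : Fin μ.card =>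
        MvPolynomial.aeval (timeVar K)
          (elemSchurPoly K ((μ.rowLen i : ℤ) - (i : ℤ) + (j : ℤ)))))) := by
    -- The size of the determinant does not depend on the number of variables, so entrywise
    -- convergence suffices.
    refine ((Continuous.matrix_det continuous_id).tendsto _).comp ?_
    exact tendsto_pi_nhds.mpr fun i => tendsto_pi_nhds.mpr fun j => tendsto_completeInt_X _
  simp only [det_completeInt _ _ _ μ μ.rowLen_card] at h
  rw [← tendsto_nhds_unique h (tendsto_schurEval_X μ), schurPoly, AlgHom.map_det]
  rfl

theorem aeval_inX_timeVar_schurPoly (μ : YoungDiagram) :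
    MvPolynomial.aeval (fun k => inX (timeVar K k)) (schurPoly K μ) = inX (schurFunction K μ) := by
  rw [← aeval_timeVar_schurPoly]
  exact (MvPolynomial.comp_aeval_apply (timeVar K)
    (MvPowerSeries.rename (Function.Embedding.inl : ℕ ↪ ℕ ⊕ ℕ)) _).symm

theorem aeval_inY_timeVar_schurPoly (μ : YoungDiagram) :
    MvPolynomial.aeval (fun k => inY (timeVar K k)) (schurPoly K μ) = inY (schurFunction K μ) := by
  rw [← aeval_timeVar_schurPoly]
  exact (MvPolynomial.comp_aeval_apply (timeVar K)
    (MvPowerSeries.rename (Function.Embedding.inr : ℕ ↪ ℕ ⊕ ℕ)) _).symm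

end InfinitelyManyVariables

/-! ### The differential equation for the product and for the sum. -/

section CauchyIdentity

variable {K : Type*} [Field K]

theorem constantCoeff_pairVar (p : ℕ × ℕ) : constantCoeff (pairVar K p) = 0 := by
  rw [pairVar, inX, inY, rename_X, rename_X, map_mul, constantCoeff_X, zero_mul]

theorem one_sub_pairVar_mul_inv (p : ℕ × ℕ) : (1 - pairVar K p) * (1 - pairVar K p)⁻¹ = 1 := by
  refine MvPowerSeries.mul_inv_cancel _ ?_
  rw [map_sub, map_one, constantCoeff_pairVar, sub_zero]
  exact one_ne_zero

theorem isHomogeneous_pairVar (p : ℕ × ℕ) : (pairVar K p).IsHomogeneous 2 := by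
  have h : (pairVar K p ^ 1).IsHomogeneous (2 * 1) := isHomogeneous_pairVar_pow p 1
  rwa [pow_one] at h

/-- Logarithmic derivatives add up, and D u = 2u for u = x_i y_j gives D(1/(1 - u)) = 2u/(1 - u)².
-/
theorem euler_prod_inv_one_sub_pairVar (S : Finset (ℕ × ℕ)) :
    euler (ℕ ⊕ ℕ) K (∏ p ∈ S, (1 - pairVar K p)⁻¹) = (∏ p ∈ S, (1 - pairVar K p)⁻¹) *
      ∑ p ∈ S, (2 : K) • (pairVar K p * (1 - pairVar K p)⁻¹) := by
  classical
  induction S using Finset.induction_on with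
  | empty => rw [Finset.prod_empty, Finset.sum_empty, mul_zero, Derivation.map_one_eq_zero]
  | insert p S hp ih =>
    have h := (euler (ℕ ⊕ ℕ) K).leibniz_of_mul_eq_one
      ((mul_comm _ _).trans (one_sub_pairVar_mul_inv (K := K) p))
    rw [map_sub, Derivation.map_one_eq_zero, IsHomogeneous.euler_eq (isHomogeneous_pairVar p),
      Nat.cast_ofNat, zero_sub, smul_eq_mul, neg_mul_neg] at h
    rw [Finset.prod_insert hp, Finset.sum_insert hp, Derivation.leibniz, ih, h]
    simp only [smul_eq_mul, mul_smul_comm, mul_add]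
    ring_nf

theorem constantCoeff_prod_inv_one_sub_pairVar (S : Finset (ℕ × ℕ)) :
    constantCoeff (∏ p ∈ S, (1 - pairVar K p)⁻¹) = 1 := by
  rw [map_prod]
  refine Finset.prod_eq_one fun p _ => ?_
  rw [MvPowerSeries.constantCoeff_inv, map_sub, map_one, constantCoeff_pairVar, sub_zero, inv_one]

theorem summable_pairVar_pow_succ [TopologicalSpace K] :
    Summable fun q : (ℕ × ℕ) × ℕ => pairVar K q.1 ^ (q.2 + 1) := by
  refine summable_of_finite_coeff_ne_zero fun d =>
    ((finite_preimage_support d).prod (Set.finite_Iio d.degree)).subset fun q hq => ?_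
  refine ⟨mem_of_coeff_pairVar_pow_ne_zero hq, ?_⟩
  have := IsHomogeneous.degree_eq (isHomogeneous_pairVar_pow q.1 (q.2 + 1)) hq
  rw [Set.mem_Iio]
  omega

theorem summable_cauchyPart [TopologicalSpace K] : Summable (cauchyPart K) :=
  summable_of_isHomogeneous (w := fun n => 2 * n) (fun m n h => by dsimp only at h; omega)
    isHomogeneous_cauchyPart

theorem mul_inX_timeVar_mul_inY_timeVar [CharZero K] (i : ℕ) :
    ((i + 1 : ℕ) : MvPowerSeries (ℕ ⊕ ℕ) K) * inX (timeVar K (i + 1)) * inY (timeVar K (i + 1)) =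
      ((i + 1 : ℕ) : K)⁻¹ • pairPowerSum K (i + 1) := by
  have hc : ((i + 1 : ℕ) : K) ≠ 0 := Nat.cast_ne_zero.mpr (Nat.succ_ne_zero i)
  rw [pairPowerSum, timeVar, inX, inY, map_smul, map_smul, mul_smul_comm, mul_smul_comm,
    smul_mul_assoc, mul_assoc, ← nsmul_eq_mul, ← Nat.cast_smul_eq_nsmul K, inv_smul_smul₀ hc]
  rfl

variable [TopologicalSpace K] [DiscreteTopology K]

theorem hasSum_pairVar_pow_succ (p : ℕ × ℕ) :
    HasSum (fun k : ℕ => pairVar K p ^ (k + 1)) (pairVar K p * (1 - pairVar K p)⁻¹) := by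
  have h0 := constantCoeff_pairVar (K := K) p
  have h := (WithPiTopology.summable_pow_of_constantCoeff_eq_zero h0).hasSum
  have h1 : ∑' k : ℕ, pairVar K p ^ k = (1 - pairVar K p)⁻¹ := by
    have h2 := WithPiTopology.one_sub_mul_tsum_pow_of_constantCoeff_eq_zero h0
    calc ∑' k : ℕ, pairVar K p ^ k
        = (1 - pairVar K p) * (1 - pairVar K p)⁻¹ * ∑' k : ℕ, pairVar K p ^ k := by
          rw [one_sub_pairVar_mul_inv, one_mul]
      _ = (1 - pairVar K p)⁻¹ := by
          rw [mul_comm (1 - pairVar K p), mul_assoc, h2, mul_one]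
  rw [h1] at h
  simpa only [pow_succ'] using h.mul_left (pairVar K p)

/-- A coefficient of degree m only sees partitions of size m/2, so the sum by size may be split into
single partitions. For odd m every term vanishes and rounding is harmless. -/
theorem hasSum_schurFunction_mul_schurFunction {F : MvPowerSeries (ℕ ⊕ ℕ) K}
    (hF : HasSum (cauchyPart K) F) :
    HasSum (fun μ : YoungDiagram => inX (schurFunction K μ) * inY (schurFunction K μ)) F := by
  refine WithPiTopology.hasSum_iff_hasSum_coeff.mpr fun d => ?_
  have hzero : ∀ l ∉ ofCard (d.degree / 2),
      coeff d (inX (schurFunction K l) * inY (schurFunction K l)) = 0 := by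
    intro l hl
    by_contra hne
    have := IsHomogeneous.degree_eq (isHomogeneous_inX_mul_inY_schurFunction l) hne
    exact hl (mem_ofCard.mpr (by omega))
  have hsum := hasSum_sum_of_ne_finset_zero (L := SummationFilter.unconditional _) hzero
  rw [← map_sum] at hsum
  change HasSum _ (coeff d (cauchyPart K _)) at hsum
  convert hsum using 1
  refine (WithPiTopology.hasSum_iff_hasSum_coeff.mp hF d).unique (hasSum_single _ fun m hm => ?_)
  by_contra hne
  have := IsHomogeneous.degree_eq (isHomogeneous_cauchyPart m) hne
  omega

/-- The n-th part has degree 2n, so D acts on it as twice the left side of Newton's identity;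
summing over n gives a Cauchy product. -/
theorem euler_tsum_cauchyPart {G : MvPowerSeries (ℕ ⊕ ℕ) K}
    (hG : HasSum (fun k => pairPowerSum K (k + 1)) G) :
    euler (ℕ ⊕ ℕ) K (∑' n, cauchyPart K n) = (∑' n, cauchyPart K n) * ((2 : K) • G) := by
  have hsum : Summable fun q : ℕ × ℕ => cauchyPart K q.1 * pairPowerSum K (q.2 + 1) := by
    refine summable_of_finite_coeff_ne_zero fun d =>
      ((Set.finite_Iic d.degree).prod (Set.finite_Iic d.degree)).subset fun q hq => ?_
    have := IsHomogeneous.degree_eq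
      (IsHomogeneous.mul (isHomogeneous_cauchyPart q.1) (isHomogeneous_pairPowerSum (q.2 + 1))) hq
    exact ⟨Set.mem_Iic.mpr (by omega), Set.mem_Iic.mpr (by omega)⟩
  have h1 := Summable.tsum_mul_tsum_eq_tsum_sum_antidiagonal (f := cauchyPart K)
    (g := fun k => pairPowerSum K (k + 1)) summable_cauchyPart hG.summable hsum
  have h2 := (summable_sum_mul_antidiagonal_of_summable_mul (f := cauchyPart K)
    (g := fun k => pairPowerSum K (k + 1)) hsum).hasSum
  rw [← h1, hG.tsum_eq] at h2
  rw [← funext succ_mul_cauchyPart] at h2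
  have h3 := summable_cauchyPart.hasSum.map (euler (ℕ ⊕ ℕ) K) continuous_euler
  rw [← hasSum_nat_add_iff' 1, Finset.sum_range_one, Function.comp_apply, cauchyPart_zero,
    Derivation.map_one_eq_zero, sub_zero] at h3
  rw [mul_smul_comm]
  refine h3.unique ?_
  have h4 : ∀ n, (euler (ℕ ⊕ ℕ) K ∘ cauchyPart K) (n + 1) = (2 : K) •
      (((n + 1 : ℕ) : MvPowerSeries (ℕ ⊕ ℕ) K) * cauchyPart K (n + 1)) := by
    intro n
    rw [Function.comp_apply, IsHomogeneous.euler_eq (isHomogeneous_cauchyPart (n + 1)), ← nsmul_eq_mul,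
      ← Nat.cast_smul_eq_nsmul K, smul_smul, Nat.cast_mul, Nat.cast_ofNat]
  rw [funext h4]
  exact h2.const_smul 2

end CauchyIdentity

theorem theorem1p2 (K : Type*) [Field K] [CharZero K] [TopologicalSpace K] [DiscreteTopology K] :
    ∃ E F : MvPowerSeries (ℕ ⊕ ℕ) K,
      -- `E = ∑_{i ≥ 1} i t_i s_i`, and `F = exp E`
      HasSum (fun i : ℕ => ((i + 1 : ℕ) : MvPowerSeries (ℕ ⊕ ℕ) K) *
        inX (timeVar K (i + 1)) * inY (timeVar K (i + 1))) E ∧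
      PowerSeries.HasSubst E ∧
      F = (PowerSeries.exp K).subst E ∧
      -- `∏_{i, j} 1 / (1 - x_i y_j) = F`
      HasProd (fun p : ℕ × ℕ =>
        (1 - inX (MvPowerSeries.X p.1) * inY (MvPowerSeries.X p.2) :
          MvPowerSeries (ℕ ⊕ ℕ) K)⁻¹) F ∧
      -- the sum over all partitions of products of Schur functions in `x` and `y`
      HasSum (fun μ : YoungDiagram => inX (schurFunction K μ) * inY (schurFunction K μ)) F ∧
      -- the sum over all partitions of products of Schur polynomials in `t` and `s`
      HasSum (fun μ : YoungDiagram =>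
        MvPolynomial.aeval (fun k : ℕ => inX (timeVar K k)) (schurPoly K μ) *
        MvPolynomial.aeval (fun k : ℕ => inY (timeVar K k)) (schurPoly K μ)) F := by
  have hw : Function.Injective fun n : ℕ => 2 * (n + 1) := fun m n h => by dsimp only at h; omega
  have hhom : ∀ i : ℕ, (((i + 1 : ℕ) : K)⁻¹ • pairPowerSum K (i + 1)).IsHomogeneous (2 * (i + 1)) :=
    fun i => IsHomogeneous.smul (isHomogeneous_pairPowerSum (i + 1)) _
  obtain ⟨E, hE⟩ := summable_of_isHomogeneous hw hhom
  obtain ⟨G, hG⟩ := summable_pairVar_pow_succ (K := K)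
  -- The family (x_i y_j)^{k+1} is summed in two orders: over k first for the product's logarithmic
  -- derivative, over (i, j) first for the power sums.
  have hG1 := hG.prod_fiberwise fun p => hasSum_pairVar_pow_succ p
  have hG2 : HasSum (fun k => pairPowerSum K (k + 1)) G :=
    ((Equiv.prodComm ℕ (ℕ × ℕ)).hasSum_iff.mpr hG).prod_fiberwise fun k => hasSum_pairVar_pow k
  have hE0 : constantCoeff E = 0 := by
    refine (WithPiTopology.hasSum_iff_hasSum_coeff.mp hE 0).unique ?_
    convert hasSum_zero with i
    by_contra hne
    have := IsHomogeneous.degree_eq (hhom i) hne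
    rw [map_zero] at this
    omega
  have hsubst : PowerSeries.HasSubst E := PowerSeries.HasSubst.of_constantCoeff_zero hE0
  have hEG : euler (ℕ ⊕ ℕ) K E = (2 : K) • G := by
    refine (hE.map (euler (ℕ ⊕ ℕ) K) continuous_euler).unique ?_
    convert hG2.const_smul (2 : K) using 2 with i
    have hc : ((i + 1 : ℕ) : K) ≠ 0 := Nat.cast_ne_zero.mpr (Nat.succ_ne_zero i)
    rw [Function.comp_apply, IsHomogeneous.euler_eq (hhom i), smul_smul, Nat.cast_mul, mul_assoc,
      mul_inv_cancel₀ hc, mul_one, Nat.cast_ofNat]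
  have hF := euler_exp_subst hsubst
  rw [hEG] at hF
  have hF1 := constantCoeff_exp_subst hE0
  have hQ1 : constantCoeff (∑' n, cauchyPart K n) = 1 := by
    have := coeff_eq_of_hasSum_isHomogeneous (summable_cauchyPart (K := K)).hasSum
      (w := fun n => 2 * n) (fun m n h => by dsimp only at h; omega) isHomogeneous_cauchyPart
      (n := 0) (d := 0) (map_zero _)
    rw [← coeff_zero_eq_constantCoeff_apply, this, cauchyPart_zero, coeff_zero_one]
  have hcauchy : HasSum (cauchyPart K) ((PowerSeries.exp K).subst E) := by
    rw [← eq_of_euler_eq_mul (euler_tsum_cauchyPart hG2) hF hQ1 hF1]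
    exact summable_cauchyPart.hasSum
  have hschur := hasSum_schurFunction_mul_schurFunction hcauchy
  refine ⟨E, (PowerSeries.exp K).subst E, ?_, hsubst, rfl, ?_, hschur, ?_⟩
  · simp only [mul_inX_timeVar_mul_inY_timeVar]
    exact hE
  -- Unconditional convergence of the product is continuous dependence along the filter of finite
  -- sets of pairs.
  · exact tendsto_of_euler_eq_mul euler_prod_inv_one_sub_pairVar hF
      constantCoeff_prod_inv_one_sub_pairVar hF1 (hG1.const_smul (2 : K))
  · simp only [aeval_inX_timeVar_schurPoly, aeval_inY_timeVar_schurPoly]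
    exact hschur
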